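/- Let $M\ge 1$ be a fixed integer. For every $N$ let $\xi_1,\dots,\xi_N$ be i.i.d. random vectors $\xi_i=(\xi_i^1,\dots,\xi_i^M)\in\{-1,+1\}^M$ with independent, centred coordinates, and write $\mathbb P_\xi$ for their law. For $\sigma\in\{-1,+1\}^N$ put $m_N^\nu(\sigma)=\frac1N\sum_{i=1}^N\sigma_i\xi_i^\nu$ $(1\le\nu\le M)$ and let $$\mu_N(\sigma)=\frac1{Z_N}\exp\Big(\frac{N}{2}\|m_N(\sigma)\|^2\Big),\qquad \sigma\in\{-1,+1\}^N,$$ be the Hopfield Gibbs measure at the critical inverse temperature $\beta=1$ (with $\|\cdot\|$ the Euclidean norm on $\mathbb R^M$ and $Z_N$ the normalizing constant). For $k\le N$ let $\mu_N^{(k)}$ be the marginal of $\mu_N$ on $(\sigma_1,\dots,\sigma_k)$, let $\pi$ be the Rademacher law ($\pi(\pm1)=\frac12$), and let $d_{\mathrm{TV}}(p,q)=\frac12\sum_x|p(x)-q(x)|$ be the total variation distance. 1. For every $c\in(0,\infty)$ there is a deterministic constant $b=b(c,M)>0$ such that, for every sequence $k=k(N)\le N$ with $k/\sqrt N\to c$,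 $$\liminf_{N\to\infty} d_{\mathrm{TV}}\big(\mu_N^{(k)},\pi^{\otimes k}\big)\ge b\quad\text{in }\mathbb P_\xi\text{-probability},\qquad\text{i.e.}\qquad \mathbb P_\xi\Big(d_{\mathrm{TV}}\big(\mu_N^{(k)},\pi^{\otimes k}\big)\ge b\Big)\longrightarrow 1\quad (N\to\infty).$$ 2. In particular, propagation of chaos fails in the critical window: if $k=k(N)\le N$ and $k\asymp\sqrt N$ (that is, $a\sqrt N\le k\le A\sqrt N$ for all large $N$ with some constants $0<a\le A<\infty$), then $d_{\mathrm{TV}}(\mu_N^{(k)},\pi^{\otimes k})$ does not converge to $0$ in $\mathbb P_\xi$-probability. 3. The scaling $k=o(\sqrt N)$ is optimal for propagation of chaos at $\beta=1$: if $k=k(N)\le N$ and $d_{\mathrm{TV}}(\mu_N^{(k)},\pi^{\otimes k})\to0$ in $\mathbb P_\xi$-probability, then $k/\sqrt N\to0$. -/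

import Mathlib

open MeasureTheory ProbabilityTheory Filter Topology Asymptotics

universe u

noncomputable section

namespace Hopfield

/-- Spins and pattern entries: the two-element type `{1, -1}` of integer units. -/
abbrev Spin : Type := ℤˣ

/-- The spin `± 1` as a real number. -/
def Spin.toReal (s : Spin) : ℝ := ((s : ℤ) : ℝ)

/-- The overlap vector `m_N(σ)`, with `m_N^ν(σ) = (1/N) ∑ i, σ_i ξ_i^ν`, in Euclidean `M`-space. -/
def overlap {N M : ℕ} (ξ : Fin N → Fin M → Spin) (σ : Fin N → Spin) :
    EuclideanSpace ℝ (Fin M) :=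
  WithLp.toLp 2 fun ν => (1 / (N : ℝ)) * ∑ i, (σ i).toReal * (ξ i ν).toReal

/-- The Boltzmann weight `exp ((β N / 2) ‖m_N(σ)‖²)`. -/
def boltzmannWeight {N M : ℕ} (β : ℝ) (ξ : Fin N → Fin M → Spin) (σ : Fin N → Spin) : ℝ :=
  Real.exp (β * N / 2 * ‖overlap ξ σ‖ ^ 2)

/-- The partition function `Z_N`. -/
def partitionFunction {N M : ℕ} (β : ℝ) (ξ : Fin N → Fin M → Spin) : ℝ :=
  ∑ σ : Fin N → Spin, boltzmannWeight β ξ σ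

/-- The probability mass function of the Hopfield Gibbs measure `μ_N` on `{-1, 1}^N`, for the
quenched patterns `ξ`. -/
def gibbs {N M : ℕ} (β : ℝ) (ξ : Fin N → Fin M → Spin) (σ : Fin N → Spin) : ℝ :=
  boltzmannWeight β ξ σ / partitionFunction β ξ

/-- The mass function of the marginal, on the first `k` coordinates, of a mass function `p` on
`{-1, 1}^N`. -/
def marginal {N k : ℕ} (hk : k ≤ N) (p : (Fin N → Spin) → ℝ) (τ : Fin k → Spin) : ℝ :=
  ∑ σ : Fin N → Spin, if (fun i : Fin k => σ (Fin.castLE hk i)) = τ then p σ else 0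

/-- The mass function of the Rademacher law `π`. -/
def rademacher (_s : Spin) : ℝ := 1 / 2

/-- The mass function of the product law `π^{⊗ k}`. -/
def rademacherProd (k : ℕ) (τ : Fin k → Spin) : ℝ := ∏ i, rademacher (τ i)

/-- Total variation distance of two probability mass functions on a finite set. -/
def tvDist {α : Type*} [Fintype α] (p q : α → ℝ) : ℝ := (1 / 2) * ∑ a, |p a - q a|

/-- `d_TV(μ_N^{(k)}, π^{⊗ k})` at inverse temperature `β`, for the quenched patterns `ξ`. -/
def chaosDist {N M k : ℕ} (hk : k ≤ N) (β : ℝ) (ξ : Fin N → Fin M → Spin) : ℝ :=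
  tvDist (marginal hk (gibbs β ξ)) (rademacherProd k)

/-- Random patterns: for every system size `N`, the vectors `ξ_1, …, ξ_N` in `{-1, 1}^M` are
independent with independent centred coordinates. Nothing is assumed about the joint law of the
patterns at different `N`; the case of one infinite sequence `ξ_1, ξ_2, …` is included. -/
structure IsDisorder {Ω : Type*} [MeasurableSpace Ω] (P : Measure Ω) {M : ℕ}
    (ξ : (N : ℕ) → Ω → Fin N → Fin M → Spin) : Prop where
  measurable : ∀ (N : ℕ) (i : Fin N) (ν : Fin M), Measurable fun ω => ξ N ω i ν
  indep : ∀ N : ℕ, iIndepFun (fun (j : Fin N × Fin M) (ω : Ω) => ξ N ω j.1 j.2) P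
  mean_zero : ∀ (N : ℕ) (i : Fin N) (ν : Fin M), ∫ ω, (ξ N ω i ν).toReal ∂P = 0

end Hopfield

end

namespace Hopfield

/-! ### Hyperbolic inequalities -/

/-! At `β = 1`, completing the square (Hubbard–Stratonovich) turns the Gibbs measure into a mixture
of product measures: given a random field `x ∈ ℝ^M` with density proportional to `fieldDensity`, the
spins are independent with means `tanh (x · ξ_i)`. Criticality removes the confining quadratic term:
up to quartic corrections the log-density is `fieldForm / 2` plus a constant, and `fieldForm` has
zero diagonal, hence zero integral over every centred ball. The quartic corrections stay bounded up
to `‖x‖ = N^(-1/4)`, so the field gives mass at most one half to a ball of radius `δ N^(-1/4)`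
(`setIntegral_fieldDensity_le`). This holds for every realization of the patterns.

Such a field is visible in `k ≥ ε√N` spins through `k‖m_k‖²`. Its mean is `M` under the Rademacher
law and rises by at least a constant times `k‖x‖²`, which is of order one, under the product law
with field `x` (`IsBalanced.le_spinMean_overlapEnergy`). Total variation controls bounded functions
only, so the statistic is truncated at a level `K`. For `√k ‖x‖` bounded, a second-moment bound
controls the truncation error (`IsBalanced.le_spinMean_min_of_le`); for larger fields Chebyshev's
inequality suffices (`IsBalanced.le_spinMean_min_of_lt`). Averaging over the field yields
`exists_le_chaosDist`.

The patterns enter only through `IsBalanced` for the first `k` of them, which Chebyshev's inequality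
gives with probability tending to one as `k → ∞`. -/

lemma sinh_le_mul_cosh {x : ℝ} (hx : 0 ≤ x) : Real.sinh x ≤ x * Real.cosh x := by
  have hd : ∀ y : ℝ, HasDerivAt (fun y => y * Real.cosh y - Real.sinh y)
      (1 * Real.cosh y + y * Real.sinh y - Real.cosh y) y := fun y =>
    ((hasDerivAt_id y).mul (Real.hasDerivAt_cosh y)).sub (Real.hasDerivAt_sinh y)
  have hm : Monotone fun y : ℝ => y * Real.cosh y - Real.sinh y := by
    refine monotone_of_deriv_nonneg (fun y => (hd y).differentiableAt) fun y => ?_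
    rw [(hd y).deriv]
    have : 0 ≤ y * Real.sinh y := by
      rcases le_total 0 y with h | h
      · exact mul_nonneg h (Real.sinh_nonneg_iff.2 h)
      · exact mul_nonneg_of_nonpos_of_nonpos h (Real.sinh_nonpos_iff.2 h)
    linarith
  have := hm hx
  simp only [Real.sinh_zero, zero_mul, sub_zero] at this
  linarith

lemma abs_tanh_le (x : ℝ) : |Real.tanh x| ≤ |x| := by
  have key : ∀ y : ℝ, 0 ≤ y → |Real.tanh y| ≤ y := by
    intro y hy
    have hs := Real.sinh_nonneg_iff.2 hy
    rw [Real.tanh_eq_sinh_div_cosh, abs_of_nonneg (div_nonneg hs (Real.cosh_pos y).le),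
      div_le_iff₀ (Real.cosh_pos y)]
    exact sinh_le_mul_cosh hy
  rcases le_total 0 x with h | h
  · rw [abs_of_nonneg h]; exact key x h
  · have := key (-x) (by linarith)
    rwa [Real.tanh_neg, abs_neg, ← abs_of_nonpos h] at this

/-- This follows from `e^(2y) ≥ 1 + 2y` for `y ≥ 0`. The bound is quadratic near zero and linear at
infinity, so it serves both small and large fields. -/
lemma sq_div_one_add_abs_le_mul_tanh (x : ℝ) : x ^ 2 / (1 + |x|) ≤ x * Real.tanh x := by
  have key : ∀ y : ℝ, 0 ≤ y → y ^ 2 / (1 + y) ≤ y * Real.tanh y := by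
    intro y hy
    have h1 : 0 < 1 + y := by linarith
    rw [sq, mul_div_assoc]
    refine mul_le_mul_of_nonneg_left ?_ hy
    rw [Real.tanh_eq_sinh_div_cosh, div_le_div_iff₀ h1 (Real.cosh_pos y), Real.cosh_eq,
      Real.sinh_eq]
    have h2 : 2 * y + 1 ≤ Real.exp (2 * y) := Real.add_one_le_exp _
    have h3 : Real.exp (2 * y) * Real.exp (-y) = Real.exp y := by
      rw [← Real.exp_add]; ring_nf
    nlinarith [mul_le_mul_of_nonneg_right h2 (Real.exp_pos (-y)).le]
  rcases le_total 0 x with h | h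
  · rw [abs_of_nonneg h]; exact key x h
  · have := key (-x) (by linarith)
    rw [Real.tanh_neg] at this
    rw [abs_of_nonpos h]
    linarith [neg_sq x ▸ this]

/-- With `u = x²/2`, one has `cosh x ≥ 1 + u` and `log (1 + u) ≥ u / (1 + u) ≥ u - u²`. The quartic
loss is what fixes the critical scale `N^(-1/4)` of the field. -/
lemma exp_sq_sub_le_cosh (x : ℝ) : Real.exp (x ^ 2 / 2 - x ^ 4 / 4) ≤ Real.cosh x := by
  have h1 : 1 + x ^ 2 / 2 ≤ Real.cosh x := by
    have h2 : (x / 2) ^ 2 ≤ Real.sinh (x / 2) ^ 2 := by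
      rcases le_total 0 (x / 2) with h | h
      · exact pow_le_pow_left₀ h (Real.self_le_sinh_iff.2 h) 2
      · rw [← neg_sq, ← neg_sq (Real.sinh _), ← Real.sinh_neg]
        exact pow_le_pow_left₀ (by linarith) (Real.self_le_sinh_iff.2 (by linarith)) 2
    have h3 := Real.cosh_two_mul (x / 2)
    rw [mul_div_cancel₀ x two_ne_zero, Real.cosh_sq] at h3
    linarith
  refine le_trans ?_ h1
  have hp : 0 < 1 + x ^ 2 / 2 := by positivity
  rw [← Real.le_log_iff_exp_le hp]
  refine le_trans ?_ (Real.one_sub_inv_le_log_of_pos hp)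
  have : x ^ 2 / 2 - x ^ 4 / 4 = (x ^ 2 / 2) * (1 - x ^ 2 / 2) := by ring
  rw [this, ← sub_nonneg]
  have e : 1 - (1 + x ^ 2 / 2)⁻¹ - x ^ 2 / 2 * (1 - x ^ 2 / 2) =
      (x ^ 2 / 2) ^ 3 / (1 + x ^ 2 / 2) := by
    field_simp
    ring
  rw [e]
  positivity

/-! ### Product laws of spins -/

lemma Spin.toReal_one : Spin.toReal 1 = 1 := by simp [Spin.toReal]

lemma Spin.toReal_neg_one : Spin.toReal (-1) = -1 := by simp [Spin.toReal]

lemma Spin.toReal_mul_self (s : Spin) : s.toReal * s.toReal = 1 := by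
  rcases Int.units_eq_one_or s with rfl | rfl <;> simp [Spin.toReal]

lemma Spin.toReal_sq (s : Spin) : s.toReal ^ 2 = 1 := by
  rw [sq, Spin.toReal_mul_self]

lemma Spin.abs_toReal (s : Spin) : |s.toReal| = 1 := by
  rcases Int.units_eq_one_or s with rfl | rfl <;> simp [Spin.toReal]

lemma Spin.sum_univ (f : Spin → ℝ) : ∑ s, f s = f 1 + f (-1) := by
  rw [UnitsInt.univ, Finset.sum_pair (by decide)]

/-- The weight of `σ` under the law of independent spins with means `t i`. -/
noncomputable def spinWeight {n : ℕ} (t : Fin n → ℝ) (σ : Fin n → Spin) : ℝ :=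
  ∏ i, (1 + (σ i).toReal * t i) / 2

/-- The mean of `F` under the law of independent spins with means `t i`. -/
noncomputable def spinMean {n : ℕ} (t : Fin n → ℝ) (F : (Fin n → Spin) → ℝ) : ℝ :=
  ∑ σ, spinWeight t σ * F σ

section spinMean

variable {n : ℕ} (t : Fin n → ℝ)

lemma spinWeight_nonneg (ht : ∀ i, |t i| ≤ 1) (σ : Fin n → Spin) : 0 ≤ spinWeight t σ := by
  refine Finset.prod_nonneg fun i _ => ?_
  have := abs_le.1 (ht i)
  rcases Int.units_eq_one_or (σ i) with h | h <;>
    simp only [h, Spin.toReal_one, Spin.toReal_neg_one] <;> linarith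

lemma spinMean_prod (f : Fin n → Spin → ℝ) :
    spinMean t (fun σ => ∏ i, f i (σ i)) =
      ∏ i, ((1 + t i) / 2 * f i 1 + (1 - t i) / 2 * f i (-1)) := by
  have h : ∀ i, (1 + t i) / 2 * f i 1 + (1 - t i) / 2 * f i (-1) =
      ∑ s, (1 + Spin.toReal s * t i) / 2 * f i s := by
    intro i
    rw [Spin.sum_univ, Spin.toReal_one, Spin.toReal_neg_one]
    ring
  simp_rw [h]
  rw [Finset.prod_univ_sum, Fintype.piFinset_univ]
  simp only [spinMean, spinWeight, Finset.prod_mul_distrib]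

lemma spinMean_one : spinMean t (fun _ => 1) = 1 := by
  have := spinMean_prod t (fun _ _ => 1)
  simp only [Finset.prod_const_one] at this
  rw [this]
  exact Finset.prod_eq_one fun i _ => by ring

lemma spinMean_const (c : ℝ) : spinMean t (fun _ => c) = c := by
  have := spinMean_one t
  simp only [spinMean, mul_one] at this
  simp [spinMean, ← Finset.sum_mul, this]

lemma spinMean_add (F G : (Fin n → Spin) → ℝ) :
    spinMean t (fun σ => F σ + G σ) = spinMean t F + spinMean t G := by
  simp [spinMean, mul_add, Finset.sum_add_distrib]

lemma spinMean_sub (F G : (Fin n → Spin) → ℝ) :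
    spinMean t (fun σ => F σ - G σ) = spinMean t F - spinMean t G := by
  simp [spinMean, mul_sub, Finset.sum_sub_distrib]

lemma spinMean_const_mul (c : ℝ) (F : (Fin n → Spin) → ℝ) :
    spinMean t (fun σ => c * F σ) = c * spinMean t F := by
  simp only [spinMean, Finset.mul_sum]
  exact Finset.sum_congr rfl fun _ _ => by ring

lemma spinMean_sum {ι : Type*} (s : Finset ι) (F : ι → (Fin n → Spin) → ℝ) :
    spinMean t (fun σ => ∑ j ∈ s, F j σ) = ∑ j ∈ s, spinMean t (F j) := by
  simp only [spinMean, Finset.mul_sum]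
  exact Finset.sum_comm

lemma spinMean_mono {t : Fin n → ℝ} (ht : ∀ i, |t i| ≤ 1) {F G : (Fin n → Spin) → ℝ}
    (h : ∀ σ, F σ ≤ G σ) : spinMean t F ≤ spinMean t G :=
  Finset.sum_le_sum fun σ _ => mul_le_mul_of_nonneg_left (h σ) (spinWeight_nonneg t ht σ)

lemma spinMean_apply (i : Fin n) : spinMean t (fun σ => (σ i).toReal) = t i := by
  have h := spinMean_prod t (fun l s => if l = i then Spin.toReal s else 1)
  simp only [Finset.prod_ite_eq', Finset.mem_univ, if_true] at h
  rw [h, Finset.prod_eq_single i]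
  · simp only [if_true, Spin.toReal_one, Spin.toReal_neg_one]; ring
  · intro j _ hj; simp only [hj, if_false]; ring
  · simp

lemma spinMean_apply_mul_apply {i j : Fin n} (hij : i ≠ j) :
    spinMean t (fun σ => (σ i).toReal * (σ j).toReal) = t i * t j := by
  have h := spinMean_prod t
    (fun l s => (if l = i then Spin.toReal s else 1) * (if l = j then Spin.toReal s else 1))
  simp only [Finset.prod_mul_distrib, Finset.prod_ite_eq', Finset.mem_univ, if_true] at h
  rw [h]
  calc _ = ∏ l, (if l = i then t l else 1) * (if l = j then t l else 1) := by
        refine Finset.prod_congr rfl fun l _ => ?_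
        by_cases h1 : l = i
        · have h2 : l ≠ j := fun h2 => hij (h1.symm.trans h2)
          simp only [h1, hij, if_true, if_false, Spin.toReal_one, Spin.toReal_neg_one]; ring
        · by_cases h2 : l = j
          · simp only [h2, hij.symm, if_true, if_false, Spin.toReal_one, Spin.toReal_neg_one]
            ring
          · simp only [h1, h2, if_false]; ring
    _ = _ := by
        rw [Finset.prod_mul_distrib]
        simp only [Finset.prod_ite_eq', Finset.mem_univ, if_true]

lemma spinMean_linear (a : Fin n → ℝ) :
    spinMean t (fun σ => ∑ i, a i * (σ i).toReal) = ∑ i, a i * t i := by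
  rw [spinMean_sum]
  exact Finset.sum_congr rfl fun i _ => by rw [spinMean_const_mul, spinMean_apply]

lemma spinMean_linear_sq (a : Fin n → ℝ) :
    spinMean t (fun σ => (∑ i, a i * (σ i).toReal) ^ 2) =
      (∑ i, a i * t i) ^ 2 + ∑ i, a i ^ 2 * (1 - t i ^ 2) := by
  have h : ∀ i j, spinMean t (fun σ => (a i * (σ i).toReal) * (a j * (σ j).toReal)) =
      (a i * t i) * (a j * t j) + if i = j then a i ^ 2 * (1 - t i ^ 2) else 0 := by
    intro i j
    have e : (fun σ : Fin n → Spin => (a i * (σ i).toReal) * (a j * (σ j).toReal)) =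
        fun σ => (a i * a j) * ((σ i).toReal * (σ j).toReal) := by funext σ; ring
    rw [e, spinMean_const_mul]
    by_cases hij : i = j
    · subst hij
      simp only [Spin.toReal_mul_self, spinMean_one, if_true]
      ring
    · rw [spinMean_apply_mul_apply t hij, if_neg hij]
      ring
  simp_rw [sq (∑ i, _), Finset.sum_mul_sum]
  rw [spinMean_sum]
  simp_rw [spinMean_sum, h, Finset.sum_add_distrib]
  simp

lemma spinMean_variance_le (a : Fin n → ℝ) :
    spinMean t (fun σ => (∑ i, a i * (σ i).toReal - ∑ i, a i * t i) ^ 2) ≤ ∑ i, a i ^ 2 := by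
  set p := ∑ i, a i * t i with hp
  have e : (fun σ : Fin n → Spin => (∑ i, a i * (σ i).toReal - p) ^ 2) =
      fun σ => (∑ i, a i * (σ i).toReal) ^ 2 - (2 * p) * (∑ i, a i * (σ i).toReal) + p ^ 2 := by
    funext σ; ring
  rw [e, spinMean_add, spinMean_sub, spinMean_const, spinMean_const_mul, spinMean_linear,
    spinMean_linear_sq, ← hp]
  have : ∑ i, a i ^ 2 * (1 - t i ^ 2) ≤ ∑ i, a i ^ 2 :=
    Finset.sum_le_sum fun i _ => by nlinarith [mul_nonneg (sq_nonneg (a i)) (sq_nonneg (t i))]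
  linarith

/-- Each factor equals `cosh a (1 + t tanh a)`; the two pieces are at most `exp (a²/2)` and `exp
(|a| |t|)`. -/
lemma spinMean_exp_le {t : Fin n → ℝ} (ht : ∀ i, |t i| ≤ 1) (a : Fin n → ℝ) :
    spinMean t (fun σ => Real.exp (∑ i, a i * (σ i).toReal)) ≤
      Real.exp (∑ i, (a i ^ 2 / 2 + |a i| * |t i|)) := by
  simp_rw [Real.exp_sum]
  rw [spinMean_prod t (fun i s => Real.exp (a i * s.toReal))]
  refine Finset.prod_le_prod (fun i _ => ?_) fun i _ => ?_
  · have := abs_le.1 (ht i)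
    have h1 : 0 ≤ (1 + t i) / 2 := by linarith
    have h2 : 0 ≤ (1 - t i) / 2 := by linarith
    positivity
  · have e : (1 + t i) / 2 * Real.exp (a i * Spin.toReal 1) +
        (1 - t i) / 2 * Real.exp (a i * Spin.toReal (-1)) =
        Real.cosh (a i) * (1 + t i * Real.tanh (a i)) := by
      have hc : Real.cosh (a i) ≠ 0 := (Real.cosh_pos _).ne'
      rw [Real.tanh_eq_sinh_div_cosh, Spin.toReal_one, Spin.toReal_neg_one]
      field_simp
      rw [Real.cosh_eq, Real.sinh_eq]
      ring
    rw [e, Real.exp_add]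
    have h1 : t i * Real.tanh (a i) ≤ |a i| * |t i| := by
      rw [mul_comm |a i|]
      refine (le_abs_self _).trans ?_
      rw [abs_mul]
      exact mul_le_mul_of_nonneg_left (abs_tanh_le _) (abs_nonneg _)
    have h2 : (1 + t i * Real.tanh (a i)) ≤ Real.exp (|a i| * |t i|) := by
      have := Real.add_one_le_exp (|a i| * |t i|)
      linarith
    exact (mul_le_mul_of_nonneg_left h2 (Real.cosh_pos _).le).trans
      (mul_le_mul_of_nonneg_right (Real.cosh_le_exp_half_sq _) (Real.exp_pos _).le)

end spinMean

/-- The weights of the last `N - k` spins sum to one, so the marginal of a product law is the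
product law of the first means. -/
lemma spinMean_comp_castLE {N k : ℕ} (hk : k ≤ N) (t : Fin N → ℝ)
    (F : (Fin k → Spin) → ℝ) :
    spinMean t (fun σ => F fun i => σ (Fin.castLE hk i)) =
      spinMean (fun i => t (Fin.castLE hk i)) F := by
  obtain ⟨l, rfl⟩ := Nat.exists_eq_add_of_le hk
  have hc : ∀ i, Fin.castLE hk i = Fin.castAdd l i := fun i => rfl
  simp only [hc, spinMean]
  rw [← (Fin.appendEquiv k l).sum_comp, Fintype.sum_prod_type]
  refine Finset.sum_congr rfl fun τ _ => ?_
  have h := spinMean_one fun i => t (Fin.natAdd k i)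
  simp only [spinMean, mul_one] at h
  simp only [Fin.appendEquiv, Equiv.coe_fn_mk, Fin.append_left, spinWeight, Fin.prod_univ_add,
    Fin.append_right]
  rw [← Finset.sum_mul, ← Finset.mul_sum]
  simp only [spinWeight] at h
  rw [h, mul_one]

/-! ### The truncated overlap as a test function -/

section Test

variable {k M : ℕ}

/-- The field `x · ξ_i` that the vector `x` exerts on the spin `i`. -/
noncomputable def localField (ξ : Fin k → Fin M → Spin) (x : EuclideanSpace ℝ (Fin M))
    (i : Fin k) : ℝ :=
  ∑ ν, x ν * (ξ i ν).toReal

/-- `k ‖m_k(σ)‖²`, where `m_k` is the overlap vector. -/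
noncomputable def overlapEnergy (ξ : Fin k → Fin M → Spin) (σ : Fin k → Spin) : ℝ :=
  (∑ ν, (∑ i, (ξ i ν).toReal * (σ i).toReal) ^ 2) / k

/-- The empirical covariance of the patterns is at least half of the identity. -/
def IsBalanced (ξ : Fin k → Fin M → Spin) : Prop :=
  ∀ x : EuclideanSpace ℝ (Fin M), k / 2 * ‖x‖ ^ 2 ≤ ∑ i, localField ξ x i ^ 2

variable (ξ : Fin k → Fin M → Spin) (x : EuclideanSpace ℝ (Fin M))

lemma sq_localField_le (i : Fin k) : localField ξ x i ^ 2 ≤ M * ‖x‖ ^ 2 := by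
  refine (Finset.sum_mul_sq_le_sq_mul_sq _ _ _).trans (le_of_eq ?_)
  simp [Spin.toReal_sq, EuclideanSpace.real_norm_sq_eq, mul_comm]

lemma abs_localField_le (i : Fin k) : |localField ξ x i| ≤ √M * ‖x‖ := by
  rw [← Real.sqrt_sq (norm_nonneg x), ← Real.sqrt_mul (Nat.cast_nonneg M), ← Real.sqrt_sq_eq_abs]
  exact Real.sqrt_le_sqrt (sq_localField_le ξ x i)

lemma sum_sq_localField_le : ∑ i, localField ξ x i ^ 2 ≤ k * (M * ‖x‖ ^ 2) := by
  refine (Finset.sum_le_sum fun i _ => sq_localField_le ξ x i).trans (le_of_eq ?_)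
  simp

lemma sum_localField_mul (s : Fin k → ℝ) :
    ∑ i, localField ξ x i * s i = ∑ ν, x ν * ∑ i, (ξ i ν).toReal * s i := by
  simp only [localField, Finset.sum_mul, Finset.mul_sum]
  rw [Finset.sum_comm]
  simp only [mul_assoc]

lemma sum_localField_mul_sq_le (s : Fin k → ℝ) :
    (∑ i, localField ξ x i * s i) ^ 2 ≤ ‖x‖ ^ 2 * ∑ ν, (∑ i, (ξ i ν).toReal * s i) ^ 2 := by
  rw [sum_localField_mul, EuclideanSpace.real_norm_sq_eq]
  exact Finset.sum_mul_sq_le_sq_mul_sq _ _ _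

lemma overlapEnergy_nonneg (σ : Fin k → Spin) : 0 ≤ overlapEnergy ξ σ := by
  unfold overlapEnergy; positivity

lemma spinMean_overlapEnergy (hk : 0 < k) (t : Fin k → ℝ) :
    spinMean t (overlapEnergy ξ) =
      M + (∑ ν, (∑ i, (ξ i ν).toReal * t i) ^ 2) / k - M / k * ∑ i, t i ^ 2 := by
  have e : overlapEnergy ξ = fun σ => (k : ℝ)⁻¹ *
      ∑ ν, (∑ i, (ξ i ν).toReal * (σ i).toReal) ^ 2 := by
    funext σ; rw [overlapEnergy, div_eq_inv_mul]
  have hk' : (k : ℝ) ≠ 0 := by exact_mod_cast hk.ne'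
  rw [e, spinMean_const_mul, spinMean_sum]
  simp_rw [spinMean_linear_sq, Spin.toReal_sq, Finset.sum_add_distrib]
  simp only [one_mul, Finset.sum_sub_distrib, Finset.sum_const, Finset.card_univ,
    Fintype.card_fin, nsmul_eq_mul, mul_one]
  field_simp
  ring

lemma spinMean_zero_overlapEnergy (hk : 0 < k) : spinMean 0 (overlapEnergy ξ) = M := by
  rw [spinMean_overlapEnergy ξ hk]
  simp

variable {ξ} in
-- All local fields are at most `√M ‖x‖` in absolute value, so a common denominator can be pulled
-- out before balance is applied to the sum of squares.
lemma IsBalanced.le_sum_mul_tanh (hξ : IsBalanced ξ) :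
    k / 2 * ‖x‖ ^ 2 / (1 + √M * ‖x‖) ≤
      ∑ i, localField ξ x i * Real.tanh (localField ξ x i) := by
  calc _ ≤ (∑ i, localField ξ x i ^ 2) / (1 + √M * ‖x‖) := by gcongr; exact hξ x
    _ = ∑ i, localField ξ x i ^ 2 / (1 + √M * ‖x‖) := Finset.sum_div _ _ _
    _ ≤ ∑ i, localField ξ x i ^ 2 / (1 + |localField ξ x i|) := by
        gcongr; exact abs_localField_le ξ x _
    _ ≤ _ := Finset.sum_le_sum fun i _ => sq_div_one_add_abs_le_mul_tanh _

variable {ξ} in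
-- The squared mean of the overlap gains `k‖x‖²/16`, by Cauchy–Schwarz in the direction `x`. The
-- reduction of the spin variances costs at most `M²‖x‖²`, which the lower bound on `k` makes at
-- most half of this gain.
lemma IsBalanced.le_spinMean_overlapEnergy (hξ : IsBalanced ξ) (hk : 0 < k)
    (hkM : 32 * (M : ℝ) ^ 2 ≤ k) (hx : √M * ‖x‖ ≤ 1) :
    M + k * ‖x‖ ^ 2 / 32 ≤
      spinMean (fun i => Real.tanh (localField ξ x i)) (overlapEnergy ξ) := by
  rw [spinMean_overlapEnergy ξ hk]
  have hk' : (0 : ℝ) < k := by exact_mod_cast hk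
  have h1 : ∑ i, Real.tanh (localField ξ x i) ^ 2 ≤ k * (M * ‖x‖ ^ 2) :=
    (Finset.sum_le_sum fun i _ => sq_le_sq.2 (abs_tanh_le _)).trans (sum_sq_localField_le ξ x)
  have h2 : M / k * ∑ i, Real.tanh (localField ξ x i) ^ 2 ≤ M ^ 2 * ‖x‖ ^ 2 := by
    calc _ ≤ M / k * (k * (M * ‖x‖ ^ 2)) := by gcongr
      _ = _ := by field_simp
  have h3 : k * ‖x‖ ^ 2 / 16 ≤
      (∑ ν, (∑ i, (ξ i ν).toReal * Real.tanh (localField ξ x i)) ^ 2) / k := by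
    rcases eq_or_ne x 0 with rfl | hx0
    · simp only [norm_zero, ne_eq, OfNat.ofNat_ne_zero, not_false_eq_true, zero_pow, mul_zero,
        zero_div]
      positivity
    have hn : 0 < ‖x‖ := norm_pos_iff.2 hx0
    have h4 : k / 4 * ‖x‖ ^ 2 ≤ ∑ i, localField ξ x i * Real.tanh (localField ξ x i) := by
      refine le_trans ?_ (hξ.le_sum_mul_tanh x)
      rw [le_div_iff₀ (by positivity)]
      have : 0 ≤ k / 4 * ‖x‖ ^ 2 * (1 - √M * ‖x‖) := by
        refine mul_nonneg (by positivity) (by linarith)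
      linarith
    have h5 := (pow_le_pow_left₀ (by positivity) h4 2).trans (sum_localField_mul_sq_le ξ x _)
    have h6 : ‖x‖ ^ 2 * (k ^ 2 * ‖x‖ ^ 2 / 16) ≤
        ‖x‖ ^ 2 * ∑ ν, (∑ i, (ξ i ν).toReal * Real.tanh (localField ξ x i)) ^ 2 :=
      le_trans (le_of_eq (by ring)) h5
    have h7 := le_of_mul_le_mul_left h6 (by positivity)
    rw [le_div_iff₀ hk']
    linarith
  have h8 : 32 * (M : ℝ) ^ 2 * ‖x‖ ^ 2 ≤ k * ‖x‖ ^ 2 := by gcongr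
  linarith

lemma pow_four_le_exp (y : ℝ) : y ^ 4 ≤ 24 * (Real.exp y + Real.exp (-y)) := by
  have h := Real.pow_div_factorial_le_exp |y| (abs_nonneg y) 4
  have h1 : |y| ^ 4 = y ^ 4 := by rw [← abs_pow, abs_of_nonneg (by positivity)]
  have h2 : Real.exp |y| ≤ Real.exp y + Real.exp (-y) := by
    rcases abs_choice y with h | h <;> rw [h] <;> linarith [Real.exp_pos y, Real.exp_pos (-y)]
  have h3 : ((Nat.factorial 4 : ℕ) : ℝ) = 24 := by norm_num [Nat.factorial]
  rw [h1, h3] at h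
  linarith

/-- The square of the energy is at most `M` times a sum of fourth powers of linear forms with
coefficients `± 1/√k`. Fourth powers are dominated by exponentials, whose means factorize. The bound
depends on `x` only through `√k ‖x‖`. -/
lemma spinMean_overlapEnergy_sq_le (hk : 0 < k) :
    spinMean (fun i => Real.tanh (localField ξ x i)) (fun σ => overlapEnergy ξ σ ^ 2) ≤
      48 * M ^ 2 * Real.exp (1 / 2 + √M * (√k * ‖x‖)) := by
  set t : Fin k → ℝ := fun i => Real.tanh (localField ξ x i) with ht
  have ht1 : ∀ i, |t i| ≤ 1 := fun i => (Real.abs_tanh_lt_one _).le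
  have hk' : (0 : ℝ) < k := by exact_mod_cast hk
  have hsk : 0 < √(k : ℝ) := Real.sqrt_pos.2 hk'
  have hexp : ∀ a : Fin k → ℝ, (∀ i, |a i| = 1 / √k) →
      spinMean t (fun σ => Real.exp (∑ i, a i * (σ i).toReal)) ≤
        Real.exp (1 / 2 + √M * (√k * ‖x‖)) := by
    intro a ha
    refine (spinMean_exp_le ht1 a).trans (Real.exp_le_exp.2 ?_)
    calc ∑ i, (a i ^ 2 / 2 + |a i| * |t i|)
        ≤ ∑ _i : Fin k, ((1 / √k) ^ 2 / 2 + 1 / √k * (√M * ‖x‖)) := by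
          refine Finset.sum_le_sum fun i _ => ?_
          rw [← sq_abs, ha]
          have := (abs_tanh_le (localField ξ x i)).trans (abs_localField_le ξ x i)
          gcongr
      _ = _ := by
          have : √(k : ℝ) ^ 2 = k := Real.sq_sqrt hk'.le
          simp only [Finset.sum_const, Finset.card_univ, Fintype.card_fin, nsmul_eq_mul]
          nth_rewrite 1 [← this]
          field_simp
  have hpt : ∀ σ, overlapEnergy ξ σ ^ 2 ≤ (24 * M : ℝ) * ∑ ν,
      (Real.exp (∑ i, ((ξ i ν).toReal / √k) * (σ i).toReal) +
        Real.exp (∑ i, (-(ξ i ν).toReal / √k) * (σ i).toReal)) := by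
    intro σ
    have e : overlapEnergy ξ σ = ∑ ν, (∑ i, ((ξ i ν).toReal / √k) * (σ i).toReal) ^ 2 := by
      rw [overlapEnergy, Finset.sum_div]
      refine Finset.sum_congr rfl fun ν _ => ?_
      nth_rewrite 1 [← Real.sq_sqrt hk'.le]
      rw [← div_pow, Finset.sum_div]
      congr 1
      exact Finset.sum_congr rfl fun i _ => by ring
    rw [e]
    refine (sq_sum_le_card_mul_sum_sq).trans ?_
    rw [Finset.card_univ, Fintype.card_fin, mul_comm (24 : ℝ), mul_assoc]
    refine mul_le_mul_of_nonneg_left ?_ (Nat.cast_nonneg M)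
    rw [Finset.mul_sum]
    refine Finset.sum_le_sum fun ν _ => ?_
    have h := pow_four_le_exp (∑ i, ((ξ i ν).toReal / √k) * (σ i).toReal)
    rw [← pow_mul]
    refine h.trans (le_of_eq ?_)
    congr 3
    rw [← Finset.sum_neg_distrib]
    exact Finset.sum_congr rfl fun i _ => by ring
  refine (spinMean_mono ht1 hpt).trans ?_
  rw [spinMean_const_mul, spinMean_sum]
  simp_rw [spinMean_add]
  calc _ ≤ (24 * M : ℝ) * ∑ _ν : Fin M, (Real.exp (1 / 2 + √M * (√k * ‖x‖)) +
        Real.exp (1 / 2 + √M * (√k * ‖x‖))) := by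
        gcongr with ν
        · exact hexp _ fun i => by rw [abs_div, Spin.abs_toReal, abs_of_pos hsk]
        · exact hexp _ fun i => by rw [abs_div, abs_neg, Spin.abs_toReal, abs_of_pos hsk]
    _ = _ := by simp; ring

/-- By AM–GM, `T ≤ K + T²/(4K)`: truncation at `K` costs at most a second moment divided by `4K`. -/
lemma sub_sq_div_le_min {T K : ℝ} (hK : 0 < K) : T - T ^ 2 / (4 * K) ≤ min T K := by
  refine le_min ?_ ?_
  · have : 0 ≤ T ^ 2 / (4 * K) := by positivity
    linarith
  · rw [sub_le_iff_le_add, ← sub_nonneg]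
    have : K + T ^ 2 / (4 * K) - T = (T - 2 * K) ^ 2 / (4 * K) := by field_simp; ring
    rw [this]
    positivity

variable {ξ} in
lemma IsBalanced.le_spinMean_min_of_le (hξ : IsBalanced ξ)
    (hkM : 256 * ((M : ℝ) + 1) ^ 3 ≤ k) {K : ℝ} (hK : 0 < K)
    (hx : √k * ‖x‖ ≤ 16 * (M + 1)) :
    M + k * ‖x‖ ^ 2 / 32 - 12 * M ^ 2 * Real.exp (1 / 2 + √M * (16 * (M + 1))) / K ≤
      spinMean (fun i => Real.tanh (localField ξ x i)) (fun σ => min (overlapEnergy ξ σ) K) := by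
  have hM : (0 : ℝ) ≤ M := Nat.cast_nonneg M
  have hk' : (0 : ℝ) < k := lt_of_lt_of_le (by positivity) hkM
  have hk : 0 < k := by exact_mod_cast hk'
  have ht1 : ∀ i, |Real.tanh (localField ξ x i)| ≤ 1 := fun i => (Real.abs_tanh_lt_one _).le
  have h1 : 32 * (M : ℝ) ^ 2 ≤ k := by nlinarith [pow_nonneg hM 3, sq_nonneg (M : ℝ)]
  have h2 : √M * ‖x‖ ≤ 1 := by
    -- This is where the threshold `256 (M + 1)³` for `k` comes from.
    have hs : √M * (16 * (M + 1)) ≤ √k := by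
      refine Real.le_sqrt_of_sq_le ?_
      rw [mul_pow, Real.sq_sqrt hM]
      nlinarith [sq_nonneg ((M : ℝ) + 1)]
    have hsk : 0 < √(k : ℝ) := Real.sqrt_pos.2 hk'
    have : √k * (√M * ‖x‖) ≤ √k * 1 := by
      calc √k * (√M * ‖x‖) = √M * (√k * ‖x‖) := by ring
        _ ≤ √M * (16 * (M + 1)) := by gcongr
        _ ≤ _ := by simpa using hs
    exact le_of_mul_le_mul_left this hsk
  have h3 := hξ.le_spinMean_overlapEnergy x hk h1 h2
  have h4 := spinMean_overlapEnergy_sq_le ξ x hk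
  have h5 : Real.exp (1 / 2 + √M * (√k * ‖x‖)) ≤ Real.exp (1 / 2 + √M * (16 * (M + 1))) := by
    gcongr
  have h6 := spinMean_mono ht1
    fun σ => sub_sq_div_le_min (T := overlapEnergy ξ σ) hK
  rw [spinMean_sub] at h6
  have e : (fun σ => overlapEnergy ξ σ ^ 2 / (4 * K)) =
      fun σ => (1 / (4 * K)) * overlapEnergy ξ σ ^ 2 := by funext σ; ring
  rw [e, spinMean_const_mul] at h6
  have h7 : 1 / (4 * K) * spinMean (fun i => Real.tanh (localField ξ x i))
      (fun σ => overlapEnergy ξ σ ^ 2) ≤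
      12 * M ^ 2 * Real.exp (1 / 2 + √M * (16 * (M + 1))) / K := by
    calc _ ≤ 1 / (4 * K) * (48 * M ^ 2 * Real.exp (1 / 2 + √M * (16 * (M + 1)))) := by
          have := h4.trans (mul_le_mul_of_nonneg_left h5 (by positivity))
          gcongr
      _ = _ := by field_simp; ring
  have e2 : spinMean (fun i => Real.tanh (localField ξ x i)) (fun σ => overlapEnergy ξ σ) =
    spinMean (fun i => Real.tanh (localField ξ x i)) (overlapEnergy ξ) := rfl
  linarith

variable {ξ} in
-- In the direction of `x`, the normalized linear statistic has mean `p ≥ 4(M + 1)` and variance at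
-- most `M`, and its square is at most the energy. Chebyshev's inequality thus makes the energy
-- large with high probability.
lemma IsBalanced.le_spinMean_min_of_lt (hξ : IsBalanced ξ)
    (hkM : 256 * ((M : ℝ) + 1) ^ 3 ≤ k) {K : ℝ} (hK : 2 * ((M : ℝ) + 1) ≤ K)
    (hx : 16 * (M + 1) < √k * ‖x‖) :
    M + 1 ≤
      spinMean (fun i => Real.tanh (localField ξ x i)) (fun σ => min (overlapEnergy ξ σ) K) := by
  have hM : (0 : ℝ) ≤ M := Nat.cast_nonneg M
  have hk' : (0 : ℝ) < k := lt_of_lt_of_le (by positivity) hkM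
  have hsk : 0 < √(k : ℝ) := Real.sqrt_pos.2 hk'
  have hskk : √(k : ℝ) ^ 2 = k := Real.sq_sqrt hk'.le
  have ht1 : ∀ i, |Real.tanh (localField ξ x i)| ≤ 1 := fun i => (Real.abs_tanh_lt_one _).le
  have hn : 0 < ‖x‖ := by
    rcases (norm_nonneg x).eq_or_lt with h | h
    · rw [← h, mul_zero] at hx; linarith
    · exact h
  set a : Fin k → ℝ := fun i => localField ξ x i / (√k * ‖x‖) with ha
  set p := ∑ i, a i * Real.tanh (localField ξ x i) with hp
  have hp1 : 4 * ((M : ℝ) + 1) ≤ p := by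
    have e : p = (∑ i, localField ξ x i * Real.tanh (localField ξ x i)) / (√k * ‖x‖) := by
      rw [hp, Finset.sum_div]
      exact Finset.sum_congr rfl fun i _ => by rw [ha]; ring
    rw [e, le_div_iff₀ (by positivity)]
    refine le_trans ?_ (hξ.le_sum_mul_tanh x)
    rw [le_div_iff₀ (by positivity)]
    have hs : √M * (16 * (M + 1)) ≤ √k := by
      refine Real.le_sqrt_of_sq_le ?_
      rw [mul_pow, Real.sq_sqrt hM]
      nlinarith [sq_nonneg ((M : ℝ) + 1)]
    have h1 : √M * (16 * (M + 1)) * ‖x‖ ≤ √k * ‖x‖ := by gcongr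
    -- Half of the right side pays for the `1`, by `hx`, and the other half for `√M * ‖x‖`, by `h1`.
    have h2 : 8 * (M + 1) * (1 + √M * ‖x‖) ≤ √k * ‖x‖ := by nlinarith
    have h3 := mul_le_mul_of_nonneg_left h2 (show 0 ≤ √k * ‖x‖ / 2 by positivity)
    calc _ = √k * ‖x‖ / 2 * (8 * (M + 1) * (1 + √M * ‖x‖)) := by ring
      _ ≤ _ := h3
      _ = √k ^ 2 / 2 * ‖x‖ ^ 2 := by ring
      _ = _ := by rw [hskk]
  have hp0 : 0 < p := lt_of_lt_of_le (by positivity) hp1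
  have hvar : ∑ i, a i ^ 2 ≤ M := by
    have e : ∑ i, a i ^ 2 = (∑ i, localField ξ x i ^ 2) / (k * ‖x‖ ^ 2) := by
      rw [Finset.sum_div]
      exact Finset.sum_congr rfl fun i _ => by rw [ha]; simp only [div_pow, mul_pow, hskk]
    rw [e, div_le_iff₀ (by positivity)]
    exact (sum_sq_localField_le ξ x).trans (le_of_eq (by ring))
  -- Chebyshev's inequality in pointwise form: a quadratic minorant of the truncated energy, at most
  -- zero once the statistic drops below `p / 2`.
  have hpt : ∀ σ : Fin k → Spin, 2 * ((M : ℝ) + 1) -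
      (8 * (M + 1) / p ^ 2) * (∑ i, a i * (σ i).toReal - p) ^ 2 ≤ min (overlapEnergy ξ σ) K := by
    intro σ
    set y := ∑ i, a i * (σ i).toReal with hy
    have hy2 : y ^ 2 ≤ overlapEnergy ξ σ := by
      have e : y = (∑ i, localField ξ x i * (σ i).toReal) / (√k * ‖x‖) := by
        rw [hy, Finset.sum_div]
        exact Finset.sum_congr rfl fun i _ => by rw [ha]; ring
      rw [e, div_pow, mul_pow, hskk, overlapEnergy, div_le_div_iff₀ (by positivity) hk']
      have := mul_le_mul_of_nonneg_right
        (sum_localField_mul_sq_le ξ x fun i => (σ i).toReal) hk'.le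
      linarith
    by_cases hyp : p / 2 ≤ y
    · have h0 : 0 ≤ (8 * ((M : ℝ) + 1) / p ^ 2) * (y - p) ^ 2 := by positivity
      have h1 : 2 * ((M : ℝ) + 1) ≤ y ^ 2 := by nlinarith
      exact le_min (by linarith) (by linarith)
    · push Not at hyp
      have h1 : p ^ 2 / 4 ≤ (y - p) ^ 2 := by nlinarith
      have h2 : 2 * ((M : ℝ) + 1) ≤ (8 * ((M : ℝ) + 1) / p ^ 2) * (y - p) ^ 2 := by
        calc 2 * ((M : ℝ) + 1) = (8 * ((M : ℝ) + 1) / p ^ 2) * (p ^ 2 / 4) := by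
              field_simp; ring
          _ ≤ _ := by gcongr
      exact (by linarith : _ ≤ (0 : ℝ)).trans
        (le_min (overlapEnergy_nonneg ξ σ) (by linarith))
  refine le_trans ?_ (spinMean_mono ht1 hpt)
  rw [spinMean_sub, spinMean_const, spinMean_const_mul]
  have hv := (spinMean_variance_le (fun i => Real.tanh (localField ξ x i)) a).trans hvar
  rw [← hp] at hv
  have : 8 * ((M : ℝ) + 1) / p ^ 2 * spinMean (fun i => Real.tanh (localField ξ x i))
      (fun σ => (∑ i, a i * (σ i).toReal - p) ^ 2) ≤ M + 1 := by
    calc _ ≤ 8 * ((M : ℝ) + 1) / p ^ 2 * M := by gcongr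
      _ ≤ M + 1 := by
        rw [div_mul_eq_mul_div, div_le_iff₀ (by positivity)]
        nlinarith
  linarith

end Test

/-! ### The Gaussian mixture representation -/

section Mixture

variable {N M : ℕ} (ξ : Fin N → Fin M → Spin)

/-- The unnormalized density, at inverse temperature one, of the random field `x` in the
representation of the Hopfield measure as a mixture of product measures. -/
noncomputable def fieldDensity (x : EuclideanSpace ℝ (Fin M)) : ℝ :=
  Real.exp (-(N / 2) * ‖x‖ ^ 2) * ∏ i, (2 * Real.cosh (localField ξ x i))

lemma prod_cosh_mul_spinWeight (u : Fin N → ℝ) (σ : Fin N → Spin) :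
    (∏ i, (2 * Real.cosh (u i))) * spinWeight (fun i => Real.tanh (u i)) σ =
      Real.exp (∑ i, u i * (σ i).toReal) := by
  rw [spinWeight, ← Finset.prod_mul_distrib, Real.exp_sum]
  refine Finset.prod_congr rfl fun i _ => ?_
  have hc : Real.cosh (u i) ≠ 0 := (Real.cosh_pos _).ne'
  rw [Real.tanh_eq_sinh_div_cosh]
  rcases Int.units_eq_one_or (σ i) with h | h
  · rw [h, Spin.toReal_one, mul_one, ← Real.cosh_add_sinh]
    field_simp
  · rw [h, Spin.toReal_neg_one, mul_neg_one, ← Real.cosh_sub_sinh]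
    field_simp
    ring

lemma inner_overlap (hN : 0 < N) (x : EuclideanSpace ℝ (Fin M)) (σ : Fin N → Spin) :
    N * inner ℝ x (overlap ξ σ) = ∑ i, localField ξ x i * (σ i).toReal := by
  have hN' : (N : ℝ) ≠ 0 := by exact_mod_cast hN.ne'
  rw [sum_localField_mul, PiLp.inner_apply, Finset.mul_sum]
  refine Finset.sum_congr rfl fun ν _ => ?_
  simp only [overlap, RCLike.inner_apply, conj_trivial]
  simp_rw [mul_comm (Spin.toReal (σ _))]
  field_simp

/-- Completing the square: `-N‖x‖²/2 + N x·m = N‖m‖²/2 - N‖x - m‖²/2`. Integrating out `x` leaves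
the Boltzmann weight times a Gaussian constant independent of `σ`. -/
lemma fieldDensity_mul_spinWeight (hN : 0 < N) (x : EuclideanSpace ℝ (Fin M))
    (σ : Fin N → Spin) :
    fieldDensity ξ x * spinWeight (fun i => Real.tanh (localField ξ x i)) σ =
      boltzmannWeight 1 ξ σ * Real.exp (-(N / 2) * ‖x - overlap ξ σ‖ ^ 2) := by
  rw [fieldDensity, mul_assoc, prod_cosh_mul_spinWeight, boltzmannWeight, ← Real.exp_add,
    ← Real.exp_add, ← inner_overlap ξ hN, norm_sub_sq_real]
  congr 1
  ring

lemma integral_gaussian_pos (hN : 0 < N) :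
    0 < ∫ x : EuclideanSpace ℝ (Fin M), Real.exp (-((N : ℝ) / 2) * ‖x‖ ^ 2) := by
  have hb : (0 : ℝ) < N / 2 := by positivity
  rw [GaussianFourier.integral_rexp_neg_mul_sq_norm hb]
  positivity

lemma integrable_gaussian_sub (hN : 0 < N) (m : EuclideanSpace ℝ (Fin M)) :
    Integrable fun x : EuclideanSpace ℝ (Fin M) => Real.exp (-((N : ℝ) / 2) * ‖x - m‖ ^ 2) :=
  (Integrable.of_integral_ne_zero (integral_gaussian_pos (M := M) hN).ne').comp_sub_right m

lemma fieldDensity_mul_spinMean (hN : 0 < N) (F : (Fin N → Spin) → ℝ)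
    (x : EuclideanSpace ℝ (Fin M)) :
    fieldDensity ξ x * spinMean (fun i => Real.tanh (localField ξ x i)) F =
      ∑ σ, boltzmannWeight 1 ξ σ * F σ *
        Real.exp (-((N : ℝ) / 2) * ‖x - overlap ξ σ‖ ^ 2) := by
  rw [spinMean, Finset.mul_sum]
  refine Finset.sum_congr rfl fun σ _ => ?_
  rw [← mul_assoc, fieldDensity_mul_spinWeight ξ hN]
  ring

lemma integrable_fieldDensity_mul_spinMean (hN : 0 < N) (F : (Fin N → Spin) → ℝ) :
    Integrable fun x => fieldDensity ξ x *
      spinMean (fun i => Real.tanh (localField ξ x i)) F := by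
  simp_rw [fieldDensity_mul_spinMean ξ hN]
  exact integrable_finsetSum _ fun σ _ => (integrable_gaussian_sub hN _).const_mul _

lemma integral_fieldDensity_mul_spinMean (hN : 0 < N) (F : (Fin N → Spin) → ℝ) :
    ∫ x, fieldDensity ξ x * spinMean (fun i => Real.tanh (localField ξ x i)) F =
      (∑ σ, boltzmannWeight 1 ξ σ * F σ) *
        ∫ x : EuclideanSpace ℝ (Fin M), Real.exp (-((N : ℝ) / 2) * ‖x‖ ^ 2) := by
  simp_rw [fieldDensity_mul_spinMean ξ hN]
  rw [integral_finsetSum _ fun σ _ => (integrable_gaussian_sub hN _).const_mul _,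
    Finset.sum_mul]
  refine Finset.sum_congr rfl fun σ _ => ?_
  rw [integral_const_mul]
  congr 1
  exact integral_sub_right_eq_self
    (fun x : EuclideanSpace ℝ (Fin M) => Real.exp (-((N : ℝ) / 2) * ‖x‖ ^ 2)) _

lemma integrable_fieldDensity (hN : 0 < N) : Integrable (fieldDensity ξ) := by
  simpa only [spinMean_one, mul_one] using
    integrable_fieldDensity_mul_spinMean ξ hN fun _ => 1

lemma integral_fieldDensity (hN : 0 < N) :
    ∫ x, fieldDensity ξ x = partitionFunction 1 ξ *
        ∫ x : EuclideanSpace ℝ (Fin M), Real.exp (-((N : ℝ) / 2) * ‖x‖ ^ 2) := by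
  simpa only [spinMean_one, mul_one, partitionFunction] using
    integral_fieldDensity_mul_spinMean ξ hN fun _ => 1

lemma fieldDensity_nonneg (x : EuclideanSpace ℝ (Fin M)) : 0 ≤ fieldDensity ξ x :=
  mul_nonneg (Real.exp_pos _).le
    (Finset.prod_nonneg fun _ _ => mul_nonneg zero_le_two (Real.cosh_pos _).le)

lemma partitionFunction_pos (β : ℝ) : 0 < partitionFunction β ξ :=
  Finset.sum_pos (fun _ _ => Real.exp_pos _) Finset.univ_nonempty

/-- A lower bound on Gibbs means from lower bounds under the product measures of the mixture. -/
lemma le_sum_gibbs_mul (hN : 0 < N) {s : Set (EuclideanSpace ℝ (Fin M))} (hs : MeasurableSet s)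
    (hhalf : ∫ x in s, fieldDensity ξ x ≤ 1 / 2 * ∫ x, fieldDensity ξ x)
    (F : (Fin N → Spin) → ℝ) {e η : ℝ} (hη : 0 ≤ η)
    (hF : ∀ x, e ≤ spinMean (fun i => Real.tanh (localField ξ x i)) F)
    (hF' : ∀ x ∉ s, e + η ≤ spinMean (fun i => Real.tanh (localField ξ x i)) F) :
    e + η / 2 ≤ ∑ σ, gibbs 1 ξ σ * F σ := by
  have hint := integrable_fieldDensity ξ hN
  have hC := integral_gaussian_pos (M := M) hN
  have hZ := partitionFunction_pos ξ 1
  have h1 : ∫ x, ((e + η) * fieldDensity ξ x - η * s.indicator (fieldDensity ξ) x) ≤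
      ∫ x, fieldDensity ξ x * spinMean (fun i => Real.tanh (localField ξ x i)) F := by
    refine integral_mono ((hint.const_mul _).sub ((hint.indicator hs).const_mul _))
      (integrable_fieldDensity_mul_spinMean ξ hN F) fun x => ?_
    have h0 := fieldDensity_nonneg ξ x
    by_cases hx : x ∈ s
    · simp only [Set.indicator_of_mem hx]
      nlinarith [mul_le_mul_of_nonneg_left (hF x) h0]
    · simp only [Set.indicator_of_notMem hx]
      nlinarith [mul_le_mul_of_nonneg_left (hF' x hx) h0]
  rw [integral_sub (hint.const_mul _) ((hint.indicator hs).const_mul _), integral_const_mul,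
    integral_const_mul, integral_indicator hs, integral_fieldDensity_mul_spinMean ξ hN] at h1
  have h2 : (e + η / 2) * ∫ x, fieldDensity ξ x ≤ (∑ σ, boltzmannWeight 1 ξ σ * F σ) *
      ∫ x : EuclideanSpace ℝ (Fin M), Real.exp (-((N : ℝ) / 2) * ‖x‖ ^ 2) := by
    nlinarith [mul_le_mul_of_nonneg_left hhalf hη]
  rw [integral_fieldDensity ξ hN, ← mul_assoc] at h2
  have h3 := le_of_mul_le_mul_right h2 hC
  have h4 : ∑ σ, gibbs 1 ξ σ * F σ =
      (∑ σ, boltzmannWeight 1 ξ σ * F σ) / partitionFunction 1 ξ := by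
    rw [Finset.sum_div]
    exact Finset.sum_congr rfl fun σ _ => by rw [gibbs]; ring
  rw [h4, le_div_iff₀ hZ]
  exact h3

/-! ### The field does not concentrate near the origin -/

/-- The quadratic form `∑ i, (x · ξ_i)² - N ‖x‖²`, which has zero diagonal. -/
noncomputable def fieldForm (x : EuclideanSpace ℝ (Fin M)) : ℝ :=
  ∑ i, localField ξ x i ^ 2 - N * ‖x‖ ^ 2

lemma continuous_localField (i : Fin N) : Continuous fun x => localField ξ x i := by
  unfold localField; fun_prop

lemma continuous_fieldForm : Continuous (fieldForm ξ) := by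
  have := continuous_localField ξ
  unfold fieldForm; fun_prop

lemma fieldForm_smul (c : ℝ) (x : EuclideanSpace ℝ (Fin M)) :
    fieldForm ξ (c • x) = c ^ 2 * fieldForm ξ x := by
  have h : ∀ i, localField ξ (c • x) i = c * localField ξ x i := fun i => by
    simp only [localField, PiLp.smul_apply, smul_eq_mul, Finset.mul_sum, mul_assoc]
  simp only [fieldForm, h, norm_smul, mul_pow, Real.norm_eq_abs, sq_abs, ← Finset.mul_sum]
  ring

lemma fieldForm_eq (x : EuclideanSpace ℝ (Fin M)) :
    fieldForm ξ x = ∑ ν, ∑ μ, (if ν = μ then 0 else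
      (∑ i, (ξ i ν).toReal * (ξ i μ).toReal) * (x ν * x μ)) := by
  have h1 : ∑ i, localField ξ x i ^ 2 =
      ∑ ν, ∑ μ, (∑ i, (ξ i ν).toReal * (ξ i μ).toReal) * (x ν * x μ) := by
    simp_rw [sq, localField, Finset.sum_mul_sum, Finset.sum_mul]
    rw [Finset.sum_comm]
    refine Finset.sum_congr rfl fun ν _ => ?_
    rw [Finset.sum_comm]
    exact Finset.sum_congr rfl fun μ _ => Finset.sum_congr rfl fun i _ => by ring
  have h2 : N * ‖x‖ ^ 2 = ∑ ν, ∑ μ, (if ν = μ then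
      (∑ i, (ξ i ν).toReal * (ξ i μ).toReal) * (x ν * x μ) else 0) := by
    rw [EuclideanSpace.real_norm_sq_eq, Finset.mul_sum]
    refine Finset.sum_congr rfl fun ν _ => ?_
    simp [Spin.toReal_mul_self, sq]
  rw [fieldForm, h1, h2, ← Finset.sum_sub_distrib]
  refine Finset.sum_congr rfl fun ν _ => ?_
  rw [← Finset.sum_sub_distrib]
  exact Finset.sum_congr rfl fun μ _ => by split_ifs <;> ring

/-- Reflecting the coordinate `ν` preserves the ball and the volume and flips the sign of the
integrand. -/
lemma setIntegral_closedBall_mul_eq_zero {ν μ : Fin M} (h : ν ≠ μ) (r : ℝ) :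
    ∫ x in Metric.closedBall (0 : EuclideanSpace ℝ (Fin M)) r, x ν * x μ = 0 := by
  let e : EuclideanSpace ℝ (Fin M) ≃ₗᵢ[ℝ] EuclideanSpace ℝ (Fin M) :=
    LinearIsometryEquiv.piLpCongrRight 2
      (fun i => if i = ν then LinearIsometryEquiv.neg ℝ else LinearIsometryEquiv.refl ℝ ℝ)
  have he := e.measurePreserving.setIntegral_preimage_emb e.toHomeomorph.measurableEmbedding
    (fun x => x ν * x μ) (Metric.closedBall 0 r)
  have hpre : e ⁻¹' Metric.closedBall 0 r = Metric.closedBall 0 r := by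
    ext x; simp
  have hν : ∀ x, e x ν = -x ν := fun x => by simp [e]
  have hμ : ∀ x, e x μ = x μ := fun x => by simp [e, h.symm]
  simp only [hpre, hν, hμ, neg_mul, integral_neg] at he
  linarith

lemma setIntegral_fieldForm (r : ℝ) :
    ∫ x in Metric.closedBall (0 : EuclideanSpace ℝ (Fin M)) r, fieldForm ξ x = 0 := by
  have hint : ∀ ν μ : Fin M, Integrable (fun x : EuclideanSpace ℝ (Fin M) => if ν = μ then 0 else
      (∑ i, (ξ i ν).toReal * (ξ i μ).toReal) * (x ν * x μ))
      (volume.restrict (Metric.closedBall 0 r)) := by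
    intro ν μ
    refine ContinuousOn.integrableOn_compact (isCompact_closedBall _ _) ?_
    split_ifs
    · exact continuousOn_const
    · fun_prop
  simp_rw [fieldForm_eq]
  rw [integral_finsetSum _ fun ν _ => integrable_finsetSum _ fun μ _ => hint ν μ]
  refine Finset.sum_eq_zero fun ν _ => ?_
  rw [integral_finsetSum _ fun μ _ => hint ν μ]
  refine Finset.sum_eq_zero fun μ _ => ?_
  split_ifs with h
  · simp
  · rw [integral_const_mul, setIntegral_closedBall_mul_eq_zero h, mul_zero]

/-- As a function of `s` the left side is convex, with zero derivative at `s = 0` because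
`fieldForm` integrates to zero; hence it increases on `[0, 1]`. No bound on the size of `fieldForm`
is needed. -/
lemma setIntegral_exp_mul_fieldForm_le {s : ℝ} (hs0 : 0 ≤ s) (hs1 : s ≤ 1) (r : ℝ) :
    ∫ x in Metric.closedBall (0 : EuclideanSpace ℝ (Fin M)) r,
        Real.exp (s * (fieldForm ξ x / 2)) ≤
      ∫ x in Metric.closedBall (0 : EuclideanSpace ℝ (Fin M)) r,
        Real.exp (fieldForm ξ x / 2) := by
  have hQ := continuous_fieldForm ξ
  have hint : ∀ f : EuclideanSpace ℝ (Fin M) → ℝ, Continuous f →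
      IntegrableOn f (Metric.closedBall 0 r) := fun f hf =>
    hf.continuousOn.integrableOn_compact (isCompact_closedBall _ _)
  have h1 : ∫ _x in Metric.closedBall (0 : EuclideanSpace ℝ (Fin M)) r, (1 : ℝ) ≤
      ∫ x in Metric.closedBall (0 : EuclideanSpace ℝ (Fin M)) r,
        Real.exp (fieldForm ξ x / 2) := by
    have h2 : ∫ x in Metric.closedBall (0 : EuclideanSpace ℝ (Fin M)) r,
        (fieldForm ξ x / 2 + 1) ≤ ∫ x in Metric.closedBall (0 : EuclideanSpace ℝ (Fin M)) r,
        Real.exp (fieldForm ξ x / 2) :=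
      integral_mono (hint _ (by fun_prop)) (hint _ (by fun_prop))
        fun x => Real.add_one_le_exp _
    rw [integral_add (hint _ (by fun_prop)) (hint _ (by fun_prop)), integral_div,
      setIntegral_fieldForm, zero_div, zero_add] at h2
    exact h2
  calc _ ≤ ∫ x in Metric.closedBall (0 : EuclideanSpace ℝ (Fin M)) r,
        ((1 - s) * 1 + s * Real.exp (fieldForm ξ x / 2)) := by
        refine integral_mono (hint _ (by fun_prop)) (hint _ (by fun_prop)) fun x => ?_
        have := convexOn_exp.2 (Set.mem_univ (0 : ℝ)) (Set.mem_univ (fieldForm ξ x / 2))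
          (sub_nonneg.2 hs1) hs0 (by ring)
        simpa only [smul_eq_mul, mul_zero, zero_add, Real.exp_zero] using this
    _ = (1 - s) * (∫ _x in Metric.closedBall (0 : EuclideanSpace ℝ (Fin M)) r, (1 : ℝ)) +
        s * ∫ x in Metric.closedBall (0 : EuclideanSpace ℝ (Fin M)) r,
          Real.exp (fieldForm ξ x / 2) := by
        rw [integral_add (hint _ (by fun_prop)) (hint _ (by fun_prop)), integral_const_mul,
          integral_const_mul]
    _ ≤ _ := by nlinarith

lemma fieldDensity_le (x : EuclideanSpace ℝ (Fin M)) :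
    fieldDensity ξ x ≤ 2 ^ N * Real.exp (fieldForm ξ x / 2) := by
  have h : ∏ i, (2 * Real.cosh (localField ξ x i)) ≤
      2 ^ N * Real.exp (∑ i, localField ξ x i ^ 2 / 2) := by
    rw [Real.exp_sum, Finset.prod_mul_distrib, Finset.prod_const, Finset.card_univ,
      Fintype.card_fin]
    gcongr with i
    exact Real.cosh_le_exp_half_sq _
  calc _ ≤ Real.exp (-(N / 2) * ‖x‖ ^ 2) *
        (2 ^ N * Real.exp (∑ i, localField ξ x i ^ 2 / 2)) :=
        mul_le_mul_of_nonneg_left h (Real.exp_pos _).le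
    _ = _ := by
        rw [mul_left_comm, ← Real.exp_add, fieldForm, ← Finset.sum_div]
        ring_nf

/-- For `‖x‖ ≤ ρ = N^(-1/4)`, the quartic terms `∑ (x · ξ_i)⁴ / 4` total at most `M²/4`. -/
lemma le_fieldDensity {ρ : ℝ} (hρ : N * ρ ^ 4 = 1) {x : EuclideanSpace ℝ (Fin M)}
    (hx : ‖x‖ ≤ ρ) :
    2 ^ N * Real.exp (-(M ^ 2 / 4)) * Real.exp (fieldForm ξ x / 2) ≤ fieldDensity ξ x := by
  have h4 : ∑ i, localField ξ x i ^ 4 ≤ M ^ 2 := by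
    calc ∑ i, localField ξ x i ^ 4 ≤ ∑ _i : Fin N, (M * ρ ^ 2) ^ 2 := by
          refine Finset.sum_le_sum fun i _ => ?_
          have h0 := (sq_localField_le ξ x i).trans
            (mul_le_mul_of_nonneg_left (pow_le_pow_left₀ (norm_nonneg x) hx 2)
              (Nat.cast_nonneg M))
          calc localField ξ x i ^ 4 = (localField ξ x i ^ 2) ^ 2 := by ring
            _ ≤ _ := pow_le_pow_left₀ (sq_nonneg _) h0 2
      _ = M ^ 2 * (N * ρ ^ 4) := by simp; ring
      _ = M ^ 2 := by rw [hρ, mul_one]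
  have h : 2 ^ N * Real.exp (∑ i, (localField ξ x i ^ 2 / 2 - localField ξ x i ^ 4 / 4)) ≤
      ∏ i, (2 * Real.cosh (localField ξ x i)) := by
    rw [Real.exp_sum, Finset.prod_mul_distrib, Finset.prod_const, Finset.card_univ,
      Fintype.card_fin]
    gcongr with i
    exact exp_sq_sub_le_cosh _
  refine le_trans ?_ (mul_le_mul_of_nonneg_left h (Real.exp_pos _).le)
  rw [mul_left_comm, mul_assoc, ← Real.exp_add, ← Real.exp_add]
  refine mul_le_mul_of_nonneg_left (Real.exp_le_exp.2 ?_) (by positivity)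
  rw [Finset.sum_sub_distrib, ← Finset.sum_div, ← Finset.sum_div, fieldForm]
  linarith

/-- Shrinking the ball of radius `ρ` by `δ` gains the Jacobian `δ^M ≤ δ`, while the dilated form has
no larger exponential integral. The choice of `δ` makes this gain beat the quartic loss `exp
(-M²/4)` by a factor of two. -/
lemma setIntegral_fieldDensity_le (hM : 1 ≤ M) (hN : 0 < N) {ρ : ℝ} (hρ0 : 0 < ρ)
    (hρ : N * ρ ^ 4 = 1) :
    ∫ x in Metric.closedBall 0 (Real.exp (-(M ^ 2 / 4)) / 2 * ρ), fieldDensity ξ x ≤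
      1 / 2 * ∫ x, fieldDensity ξ x := by
  set δ : ℝ := Real.exp (-(M ^ 2 / 4)) / 2 with hδ
  have hδ0 : 0 < δ := by positivity
  have hδ1 : δ ≤ 1 := by
    have : Real.exp (-((M : ℝ) ^ 2 / 4)) ≤ 1 := Real.exp_le_one_iff.2 (by
      have : (0 : ℝ) ≤ M ^ 2 / 4 := by positivity
      linarith)
    linarith
  have hQ := continuous_fieldForm ξ
  have hint := integrable_fieldDensity ξ hN
  have hintc : ∀ (f : EuclideanSpace ℝ (Fin M) → ℝ) (r : ℝ), Continuous f →
      IntegrableOn f (Metric.closedBall 0 r) := fun f r hf =>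
    hf.continuousOn.integrableOn_compact (isCompact_closedBall _ _)
  set J := ∫ x in Metric.closedBall (0 : EuclideanSpace ℝ (Fin M)) ρ,
    Real.exp (fieldForm ξ x / 2) with hJ
  have hJ0 : 0 ≤ J := integral_nonneg fun x => (Real.exp_pos _).le
  have h1 : ∫ x in Metric.closedBall 0 (δ * ρ), fieldDensity ξ x ≤ 2 ^ N * (δ * J) := by
    calc _ ≤ ∫ x in Metric.closedBall (0 : EuclideanSpace ℝ (Fin M)) (δ * ρ),
          2 ^ N * Real.exp (fieldForm ξ x / 2) :=
          integral_mono hint.integrableOn (hintc _ _ (by fun_prop)) fun x => fieldDensity_le ξ x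
      _ = 2 ^ N * (δ ^ M * ∫ x in Metric.closedBall (0 : EuclideanSpace ℝ (Fin M)) ρ,
          Real.exp (δ ^ 2 * (fieldForm ξ x / 2))) := by
          have h := Measure.setIntegral_comp_smul_of_pos volume
            (fun x : EuclideanSpace ℝ (Fin M) => Real.exp (fieldForm ξ x / 2))
            (Metric.closedBall 0 ρ) hδ0
          rw [smul_closedBall _ _ hρ0.le, smul_zero, Real.norm_of_nonneg hδ0.le,
            finrank_euclideanSpace_fin, smul_eq_mul] at h
          simp_rw [fieldForm_smul, mul_div_assoc] at h
          rw [h, integral_const_mul, ← mul_assoc (δ ^ M), mul_inv_cancel₀ (by positivity),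
            one_mul]
      _ ≤ 2 ^ N * (δ * J) := by
          have h2 := setIntegral_exp_mul_fieldForm_le ξ (sq_nonneg δ)
            (pow_le_one₀ hδ0.le hδ1) ρ
          have h3 : δ ^ M ≤ δ := by
            simpa using pow_le_pow_of_le_one hδ0.le hδ1 hM
          refine mul_le_mul_of_nonneg_left ?_ (by positivity)
          exact mul_le_mul h3 h2 (integral_nonneg fun x => (Real.exp_pos _).le) hδ0.le
  have h2 : 2 ^ N * Real.exp (-(M ^ 2 / 4)) * J ≤ ∫ x, fieldDensity ξ x := by
    calc _ = ∫ x in Metric.closedBall (0 : EuclideanSpace ℝ (Fin M)) ρ,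
          2 ^ N * Real.exp (-(M ^ 2 / 4)) * Real.exp (fieldForm ξ x / 2) := by
          rw [integral_const_mul]
      _ ≤ ∫ x in Metric.closedBall 0 ρ, fieldDensity ξ x :=
          setIntegral_mono_on (hintc _ _ (by fun_prop)) hint.integrableOn
            Metric.isClosed_closedBall.measurableSet fun x hx =>
              le_fieldDensity ξ hρ (by simpa using hx)
      _ ≤ _ := setIntegral_le_integral hint (ae_of_all _ (fieldDensity_nonneg ξ))
  calc _ ≤ 2 ^ N * (δ * J) := h1
    _ = 1 / 2 * (2 ^ N * Real.exp (-(M ^ 2 / 4)) * J) := by rw [hδ]; ring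
    _ ≤ _ := by gcongr

end Mixture

/-! ### Lower bound on the total variation distance for balanced patterns -/

/-- The factor `2` reflects that `p` and `q` need not have equal mass, so `h` cannot be recentred.
-/
lemma sum_sub_mul_le_tvDist {α : Type*} [Fintype α] (p q h : α → ℝ) {K : ℝ}
    (h0 : ∀ a, 0 ≤ h a) (hK : ∀ a, h a ≤ K) :
    ∑ a, p a * h a - ∑ a, q a * h a ≤ 2 * K * tvDist p q := by
  have : 2 * K * tvDist p q = ∑ a, |p a - q a| * K := by
    rw [tvDist, ← Finset.sum_mul]; ring
  rw [this, ← Finset.sum_sub_distrib]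
  refine Finset.sum_le_sum fun a _ => ?_
  rw [← sub_mul]
  exact (mul_le_mul_of_nonneg_right (le_abs_self _) (h0 a)).trans
    (mul_le_mul_of_nonneg_left (hK a) (abs_nonneg _))

lemma sum_marginal_mul {N k : ℕ} (hk : k ≤ N) (p : (Fin N → Spin) → ℝ)
    (h : (Fin k → Spin) → ℝ) :
    ∑ τ, marginal hk p τ * h τ = ∑ σ, p σ * h fun i => σ (Fin.castLE hk i) := by
  simp only [marginal, Finset.sum_mul]
  rw [Finset.sum_comm]
  refine Finset.sum_congr rfl fun σ _ => ?_
  simp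

lemma sum_rademacherProd_mul {k : ℕ} (h : (Fin k → Spin) → ℝ) :
    ∑ τ, rademacherProd k τ * h τ = spinMean 0 h := by
  simp [spinMean, spinWeight, rademacherProd, rademacher]

lemma le_chaosDist {N M k : ℕ} (hk : k ≤ N) (ξ : Fin N → Fin M → Spin)
    (h : (Fin k → Spin) → ℝ) {K : ℝ} (h0 : ∀ τ, 0 ≤ h τ) (hK : ∀ τ, h τ ≤ K) :
    ∑ σ, gibbs 1 ξ σ * h (fun i => σ (Fin.castLE hk i)) - spinMean 0 h ≤
      2 * K * chaosDist hk 1 ξ := by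
  rw [← sum_marginal_mul, ← sum_rademacherProd_mul]
  exact sum_sub_mul_le_tvDist _ _ h h0 hK

theorem exists_le_chaosDist {M : ℕ} (hM : 1 ≤ M) {ε : ℝ} (hε : 0 < ε) :
    ∃ b : ℝ, 0 < b ∧ ∀ (N k : ℕ) (hk : k ≤ N) (ξ : Fin N → Fin M → Spin),
      256 * ((M : ℝ) + 1) ^ 3 ≤ k → ε * √N ≤ k →
      IsBalanced (fun i : Fin k => ξ (Fin.castLE hk i)) → b ≤ chaosDist hk 1 ξ := by
  set δ : ℝ := Real.exp (-(M ^ 2 / 4)) / 2 with hδ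
  have hδ0 : 0 < δ := by positivity
  set η : ℝ := min (ε * δ ^ 2 / 32) 1 with hη
  have hη0 : 0 < η := by positivity
  have hη1 : η ≤ 1 := min_le_right _ _
  set c : ℝ := 12 * M ^ 2 * Real.exp (1 / 2 + √M * (16 * (M + 1))) with hc
  have hc0 : 0 < c := by
    have : (0 : ℝ) < M := by exact_mod_cast hM
    positivity
  -- The first summand serves the large-field bound; the second keeps the truncation error `c / K`
  -- below `η / 4`.
  set K : ℝ := 2 * (M + 1) + 4 * c / η with hKdef
  have hM0 : (0 : ℝ) ≤ M := Nat.cast_nonneg M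
  have hK1 : 2 * ((M : ℝ) + 1) ≤ K := by
    have : 0 < 4 * c / η := by positivity
    linarith
  have hK0 : 0 < K := by positivity
  have hcK : c / K ≤ η / 4 := by
    rw [div_le_iff₀ hK0]
    calc c = η / 4 * (4 * c / η) := by field_simp
      _ ≤ _ := by gcongr; linarith
  -- The Gibbs mean of the test function is at least `M - η/4 + η/2`, against at most `M` for the
  -- Rademacher law; the gap `η / 4` is divided by `2 * K`.
  refine ⟨η / (8 * K), by positivity, fun N k hk ξ hkM hkN hbal => ?_⟩
  have hk' : (0 : ℝ) < k := lt_of_lt_of_le (by positivity) hkM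
  have hk0 : 0 < k := by exact_mod_cast hk'
  have hN : 0 < N := hk0.trans_le hk
  have hN' : (0 : ℝ) < N := by exact_mod_cast hN
  set ζ : Fin k → Fin M → Spin := fun i => ξ (Fin.castLE hk i) with hζ
  set h : (Fin k → Spin) → ℝ := fun τ => min (overlapEnergy ζ τ) K with hh
  set ρ : ℝ := (√√N)⁻¹ with hρ
  have hs : 0 < √√(N : ℝ) := Real.sqrt_pos.2 (Real.sqrt_pos.2 hN')
  have hs2 : √√(N : ℝ) ^ 2 = √N := Real.sq_sqrt (Real.sqrt_nonneg _)
  have hρ0 : 0 < ρ := inv_pos.2 hs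
  have hρ4 : N * ρ ^ 4 = 1 := by
    have : √√(N : ℝ) ^ 4 = (N : ℝ) := by
      calc √√(N : ℝ) ^ 4 = (√√(N : ℝ) ^ 2) ^ 2 := by ring
        _ = (N : ℝ) := by rw [hs2, Real.sq_sqrt hN'.le]
    rw [hρ, inv_pow, this, mul_inv_cancel₀ hN'.ne']
  have hmean : ∀ x : EuclideanSpace ℝ (Fin M),
      spinMean (fun i => Real.tanh (localField ξ x i))
        (fun σ => h fun i => σ (Fin.castLE hk i)) =
      spinMean (fun i => Real.tanh (localField ζ x i)) h := fun x =>
    spinMean_comp_castLE hk _ h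
  have hsmall : ∀ x : EuclideanSpace ℝ (Fin M), √k * ‖x‖ ≤ 16 * (M + 1) →
      M + k * ‖x‖ ^ 2 / 32 - η / 4 ≤ spinMean (fun i => Real.tanh (localField ζ x i)) h := by
    intro x hx
    have := hbal.le_spinMean_min_of_le x hkM hK0 hx
    rw [← hc] at this
    exact le_trans (by linarith) this
  have hlarge : ∀ x : EuclideanSpace ℝ (Fin M), 16 * (M + 1) < √k * ‖x‖ →
      (M : ℝ) + 1 ≤ spinMean (fun i => Real.tanh (localField ζ x i)) h := fun x hx =>
    hbal.le_spinMean_min_of_lt x hkM hK1 hx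
  have hgibbs := le_sum_gibbs_mul ξ hN (Metric.isClosed_closedBall.measurableSet)
    (setIntegral_fieldDensity_le ξ hM hN hρ0 hρ4)
    (fun σ => h fun i => σ (Fin.castLE hk i)) (e := M - η / 4) (η := η) hη0.le
    (fun x => by
      rw [hmean]
      rcases le_or_gt (√k * ‖x‖) (16 * (M + 1)) with hx | hx
      · have : 0 ≤ k * ‖x‖ ^ 2 / 32 := by positivity
        linarith [hsmall x hx]
      · linarith [hlarge x hx])
    (fun x hxs => by
      rw [hmean]
      rcases le_or_gt (√k * ‖x‖) (16 * (M + 1)) with hx | hx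
      · have h1 : δ * ρ < ‖x‖ := by simpa using hxs
        have h2 : (δ * ρ) ^ 2 ≤ ‖x‖ ^ 2 := pow_le_pow_left₀ (by positivity) h1.le 2
        have h3 : ε * δ ^ 2 ≤ k * ‖x‖ ^ 2 := by
          calc ε * δ ^ 2 = ε * √N * (δ * ρ) ^ 2 := by
                rw [mul_pow, hρ, inv_pow, hs2]
                have : √(N : ℝ) ≠ 0 := (Real.sqrt_pos.2 hN').ne'
                field_simp
            _ ≤ _ := by gcongr
        have h4 : η ≤ ε * δ ^ 2 / 32 := min_le_left _ _
        linarith [hsmall x hx]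
      · linarith [hlarge x hx])
  have hzero : spinMean 0 h ≤ M := by
    rw [← spinMean_zero_overlapEnergy ζ hk0]
    exact spinMean_mono (by simp) fun τ => min_le_left _ _
  have hfin := le_chaosDist hk ξ h (K := K)
    (fun τ => le_min (overlapEnergy_nonneg ζ τ) hK0.le) (fun τ => min_le_right _ _)
  rw [div_le_iff₀ (by positivity)]
  linarith

/-! ### Random patterns are balanced with high probability -/

/-- The diagonal of the covariance contributes exactly `k‖x‖²`; the off-diagonal entries remove at
most half of it, since `(∑ |x ν|)² ≤ M‖x‖²`. -/
lemma isBalanced_of_abs_le {k M : ℕ} (hM : 1 ≤ M) (ξ : Fin k → Fin M → Spin)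
    (h : ∀ ν μ, ν ≠ μ → |∑ i, (ξ i ν).toReal * (ξ i μ).toReal| ≤ k / (2 * M)) :
    IsBalanced ξ := by
  intro x
  have hM' : (0 : ℝ) < M := by exact_mod_cast hM
  have h1 : -fieldForm ξ x ≤ k / (2 * M) * (∑ ν, |x ν|) ^ 2 := by
    rw [fieldForm_eq, sq, Finset.sum_mul_sum, Finset.mul_sum, ← Finset.sum_neg_distrib]
    refine Finset.sum_le_sum fun ν _ => ?_
    rw [Finset.mul_sum, ← Finset.sum_neg_distrib]
    refine Finset.sum_le_sum fun μ _ => ?_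
    split_ifs with hνμ
    · rw [neg_zero]; positivity
    · refine (neg_le_abs _).trans ?_
      rw [abs_mul, abs_mul]
      gcongr
      exact h ν μ hνμ
  have h2 : (∑ ν, |x ν|) ^ 2 ≤ M * ‖x‖ ^ 2 := by
    have := sq_sum_le_card_mul_sum_sq (s := Finset.univ) (f := fun ν => |x ν|)
    simpa [EuclideanSpace.real_norm_sq_eq] using this
  have h3 : k / (2 * M) * (∑ ν, |x ν|) ^ 2 ≤ k / 2 * ‖x‖ ^ 2 := by
    calc _ ≤ k / (2 * M) * (M * ‖x‖ ^ 2) := by gcongr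
      _ = _ := by field_simp
  rw [fieldForm] at h1
  linarith

section Disorder

variable {Ω : Type*} [MeasurableSpace Ω] {P : Measure Ω} [IsProbabilityMeasure P] {M : ℕ}
  {ξ : (N : ℕ) → Ω → Fin N → Fin M → Spin}

lemma measurable_toReal : Measurable Spin.toReal :=
  (measurable_from_top (f := fun z : ℤ => (z : ℝ))).comp (comap_measurable Units.val)

/-- For `ν ≠ μ` the products of entries are centred, bounded by one and pairwise independent in `i`,
so their sum has variance at most `k` and Chebyshev's inequality applies. -/
lemma IsDisorder.measure_abs_sum_lt_le (hξ : IsDisorder P ξ) {N k : ℕ} (hk : k ≤ N)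
    (hk0 : 0 < k) (hM : 1 ≤ M) {ν μ : Fin M} (hνμ : ν ≠ μ) :
    P {ω | k / (2 * M) < |∑ i : Fin k, (ξ N ω (Fin.castLE hk i) ν).toReal *
      (ξ N ω (Fin.castLE hk i) μ).toReal|} ≤ ENNReal.ofReal (4 * M ^ 2 / k) := by
  have hM' : (0 : ℝ) < M := by exact_mod_cast hM
  have hk' : (0 : ℝ) < k := by exact_mod_cast hk0
  have hmeas : ∀ i ν, Measurable fun ω => (ξ N ω i ν).toReal := fun i ν =>
    measurable_toReal.comp (hξ.measurable N i ν)
  set X : Fin k → Ω → ℝ := fun i ω => (ξ N ω (Fin.castLE hk i) ν).toReal *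
      (ξ N ω (Fin.castLE hk i) μ).toReal with hX
  have hXm : ∀ i, Measurable (X i) := fun i => (hmeas _ _).mul (hmeas _ _)
  have hXL : ∀ i, MemLp (X i) 2 P := fun i =>
    MemLp.of_bound (hXm i).aestronglyMeasurable 1
      (ae_of_all _ fun ω => by simp [hX, Spin.abs_toReal])
  have hX0 : ∀ i, ∫ ω, X i ω ∂P = 0 := by
    intro i
    have hind := (hξ.indep N).indepFun
      (show ((Fin.castLE hk i, ν) : Fin N × Fin M) ≠ (Fin.castLE hk i, μ) by simp [hνμ])
    have hind' := hind.comp measurable_toReal measurable_toReal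
    have := hind'.integral_fun_mul_eq_mul_integral
      (hmeas _ _).aestronglyMeasurable (hmeas _ _).aestronglyMeasurable
    simp only [Function.comp] at this
    rw [hX]
    simp only
    rw [this, hξ.mean_zero, zero_mul]
  have hXi : Set.Pairwise (↑(Finset.univ : Finset (Fin k)))
      fun i j => IndepFun (X i) (X j) P := by
    intro i _ j _ hij
    have hij' : Fin.castLE hk i ≠ Fin.castLE hk j := fun h => hij (Fin.castLE_injective hk h)
    have hind := (hξ.indep N).indepFun_prodMk_prodMk (fun p => hξ.measurable N p.1 p.2)
      (Fin.castLE hk i, ν) (Fin.castLE hk i, μ) (Fin.castLE hk j, ν) (Fin.castLE hk j, μ)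
      (by simp [hij']) (by simp [hij']) (by simp [hij']) (by simp [hij'])
    have hmul : Measurable fun s : Spin × Spin => s.1.toReal * s.2.toReal :=
      (measurable_toReal.comp measurable_fst).mul (measurable_toReal.comp measurable_snd)
    exact hind.comp hmul hmul
  have hvar : Var[∑ i, X i; P] ≤ k := by
    rw [IndepFun.variance_sum (fun i _ => hXL i) hXi]
    calc ∑ i, Var[X i; P] ≤ ∑ _i : Fin k, (1 : ℝ) := by
          refine Finset.sum_le_sum fun i _ => ?_
          refine (variance_le_expectation_sq (hXm i).aestronglyMeasurable).trans (le_of_eq ?_)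
          simp [hX, mul_pow, Spin.toReal_sq]
      _ = k := by simp
  have hmean : P[∑ i, X i] = 0 := by
    simp only [Finset.sum_apply]
    rw [integral_finsetSum _ fun i _ => (hXL i).integrable (by norm_num)]
    simp [hX0]
  have hcheb := meas_ge_le_variance_div_sq (memLp_finsetSum' Finset.univ fun i _ => hXL i)
    (show 0 < (k : ℝ) / (2 * M) by positivity)
  rw [hmean] at hcheb
  refine (measure_mono fun ω hω => ?_).trans (hcheb.trans (ENNReal.ofReal_le_ofReal ?_))
  · simp only [Set.mem_ofPred_eq, Finset.sum_apply, sub_zero] at hω ⊢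
    exact hω.le
  · calc Var[∑ i, X i; P] / ((k : ℝ) / (2 * M)) ^ 2 ≤ k / ((k : ℝ) / (2 * M)) ^ 2 := by gcongr
      _ = 4 * (M : ℝ) ^ 2 / k := by field_simp; ring

lemma IsDisorder.measure_not_isBalanced_le (hξ : IsDisorder P ξ) {N k : ℕ} (hk : k ≤ N)
    (hk0 : 0 < k) (hM : 1 ≤ M) :
    P {ω | ¬ IsBalanced fun i : Fin k => ξ N ω (Fin.castLE hk i)} ≤
      ENNReal.ofReal (4 * M ^ 4 / k) := by
  have hsub : {ω | ¬ IsBalanced fun i : Fin k => ξ N ω (Fin.castLE hk i)} ⊆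
      ⋃ p ∈ (Finset.univ : Finset (Fin M)).offDiag,
        {ω | k / (2 * M) < |∑ i : Fin k, (ξ N ω (Fin.castLE hk i) p.1).toReal *
          (ξ N ω (Fin.castLE hk i) p.2).toReal|} := by
    intro ω hω
    by_contra hcon
    refine hω (isBalanced_of_abs_le hM _ fun ν μ hνμ => ?_)
    by_contra hlt
    push Not at hlt
    exact hcon (Set.mem_biUnion (x := (ν, μ)) (by simpa using hνμ) hlt)
  refine (measure_mono hsub).trans ((measure_biUnion_finset_le _ _).trans ?_)
  calc _ ≤ ∑ _p ∈ (Finset.univ : Finset (Fin M)).offDiag, ENNReal.ofReal (4 * M ^ 2 / k) :=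
        Finset.sum_le_sum fun p hp =>
          hξ.measure_abs_sum_lt_le hk hk0 hM (by simpa using hp)
    _ ≤ ∑ _p : Fin M × Fin M, ENNReal.ofReal (4 * M ^ 2 / k) :=
        Finset.sum_le_sum_of_subset (Finset.subset_univ _)
    _ = ENNReal.ofReal (4 * M ^ 4 / k) := by
        rw [Finset.sum_const, nsmul_eq_mul, ← ENNReal.ofReal_natCast, ← ENNReal.ofReal_mul
          (Nat.cast_nonneg _)]
        congr 1
        simp
        ring

/-- If `k` is at least of order `√N` along a filter of system sizes, the distance to the product
law is bounded below with high probability along that filter. -/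
theorem exists_tendsto_measure_le_chaosDist (hM : 1 ≤ M) {ε : ℝ} (hε : 0 < ε) :
    ∃ b : ℝ, 0 < b ∧ ∀ (k : ℕ → ℕ) (hk : ∀ N, k N ≤ N) (l : Filter ℕ), l ≤ atTop →
      (∀ᶠ N : ℕ in l, ε * √N ≤ k N) →
      ∀ (Ω : Type u) [MeasurableSpace Ω] (P : Measure Ω) [IsProbabilityMeasure P]
        (ξ : (N : ℕ) → Ω → Fin N → Fin M → Spin), IsDisorder P ξ →
        Tendsto (fun N => P {ω | b ≤ chaosDist (hk N) 1 (ξ N ω)}) l (𝓝 1) := by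
  obtain ⟨b, hb, H⟩ := exists_le_chaosDist hM hε
  refine ⟨b, hb, fun k hk l hl hkl Ω _ P _ ξ hξ => ?_⟩
  have hsqrt : Tendsto (fun N : ℕ => ε * √(N : ℝ)) l atTop :=
    ((Real.tendsto_sqrt_atTop.comp tendsto_natCast_atTop_atTop).const_mul_atTop hε).mono_left hl
  have hktop : Tendsto (fun N => (k N : ℝ)) l atTop := tendsto_atTop_mono' l hkl hsqrt
  have hlow : Tendsto (fun N => 1 - ENNReal.ofReal (4 * (M : ℝ) ^ 4 / k N)) l (𝓝 1) := by
    have h1 : Tendsto (fun N => ENNReal.ofReal (4 * (M : ℝ) ^ 4 / k N)) l (𝓝 0) := by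
      simpa using ENNReal.tendsto_ofReal (hktop.const_div_atTop (4 * (M : ℝ) ^ 4))
    simpa using ENNReal.Tendsto.sub tendsto_const_nhds h1 (Or.inl ENNReal.one_ne_top)
  refine tendsto_of_tendsto_of_tendsto_of_le_of_le' hlow tendsto_const_nhds ?_
    (Eventually.of_forall fun N => prob_le_one)
  filter_upwards [hkl, hktop.eventually_ge_atTop (256 * ((M : ℝ) + 1) ^ 3)] with N h1 h2
  have hk0 : 0 < k N := by
    have : (0 : ℝ) < k N := lt_of_lt_of_le (by positivity) h2
    exact_mod_cast this
  rw [tsub_le_iff_right]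
  set A : Set Ω := {ω | ¬ IsBalanced fun i : Fin (k N) => ξ N ω (Fin.castLE (hk N) i)} with hA
  calc 1 = P Set.univ := measure_univ.symm
    _ ≤ P ({ω | b ≤ chaosDist (hk N) 1 (ξ N ω)} ∪ A) := by
        refine measure_mono fun ω _ => ?_
        by_cases hω : ω ∈ A
        · exact Or.inr hω
        · exact Or.inl (H N (k N) (hk N) (ξ N ω) h2 h1 (not_not.1 hω))
    _ ≤ P {ω | b ≤ chaosDist (hk N) 1 (ξ N ω)} + P A := measure_union_le _ _
    _ ≤ _ := by gcongr; exact hξ.measure_not_isBalanced_le (hk N) hk0 hM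

/-- Along a nontrivial filter on which `k` is at least of order `√N`, propagation of chaos
fails. -/
theorem not_tendstoInMeasure_chaosDist (hM : 1 ≤ M) {ε : ℝ} (hε : 0 < ε) {k : ℕ → ℕ}
    (hk : ∀ N, k N ≤ N) {l : Filter ℕ} [l.NeBot] (hl : l ≤ atTop)
    (hkl : ∀ᶠ N : ℕ in l, ε * √N ≤ k N) (hξ : IsDisorder P ξ) :
    ¬ TendstoInMeasure P (fun N ω => chaosDist (hk N) 1 (ξ N ω)) l fun _ => (0 : ℝ) := by
  obtain ⟨b, hb, H⟩ := exists_tendsto_measure_le_chaosDist hM hε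
  intro hT
  have h1 := H k hk l hl hkl Ω P ξ hξ
  have h0 := tendstoInMeasure_iff_norm.1 hT b hb
  have h2 : Tendsto (fun N => P {ω | b ≤ chaosDist (hk N) 1 (ξ N ω)}) l (𝓝 0) := by
    refine tendsto_of_tendsto_of_tendsto_of_le_of_le tendsto_const_nhds h0
      (fun N => zero_le) fun N => measure_mono fun ω hω => ?_
    simp only [Set.mem_ofPred_eq, sub_zero, Real.norm_eq_abs] at hω ⊢
    exact hω.trans (le_abs_self _)
  exact one_ne_zero (tendsto_nhds_unique h1 h2)

end Disorder

end Hopfield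
-- Deduction of the three statements
theorem theorem4 (M : ℕ) (hM : 1 ≤ M) :
    -- breakdown with a constant that depends only on `c` and `M`
    (∀ c : ℝ, 0 < c → ∃ b : ℝ, 0 < b ∧
      ∀ (k : ℕ → ℕ) (hk : ∀ N, k N ≤ N),
        Tendsto (fun N : ℕ => (k N : ℝ) / Real.sqrt N) atTop (𝓝 c) →
        ∀ (Ω : Type u) [MeasurableSpace Ω] (P : Measure Ω) [IsProbabilityMeasure P]
          (ξ : (N : ℕ) → Ω → Fin N → Fin M → Hopfield.Spin), Hopfield.IsDisorder P ξ →
          Tendsto (fun N => P {ω | b ≤ Hopfield.chaosDist (hk N) 1 (ξ N ω)}) atTop (𝓝 1)) ∧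
    -- propagation of chaos fails in the whole critical window
    (∀ (k : ℕ → ℕ) (hk : ∀ N, k N ≤ N),
        (fun N : ℕ => (k N : ℝ)) =Θ[atTop] (fun N : ℕ => Real.sqrt N) →
        ∀ (Ω : Type u) [MeasurableSpace Ω] (P : Measure Ω) [IsProbabilityMeasure P]
          (ξ : (N : ℕ) → Ω → Fin N → Fin M → Hopfield.Spin), Hopfield.IsDisorder P ξ →
          ¬ TendstoInMeasure P (fun N ω => Hopfield.chaosDist (hk N) 1 (ξ N ω)) atTop
            (fun _ => (0 : ℝ))) ∧
    -- the scaling `k = o(√N)` is optimal: propagation of chaos forces it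
    (∀ (k : ℕ → ℕ) (hk : ∀ N, k N ≤ N)
        (Ω : Type u) [MeasurableSpace Ω] (P : Measure Ω) [IsProbabilityMeasure P]
          (ξ : (N : ℕ) → Ω → Fin N → Fin M → Hopfield.Spin), Hopfield.IsDisorder P ξ →
          TendstoInMeasure P (fun N ω => Hopfield.chaosDist (hk N) 1 (ξ N ω)) atTop
            (fun _ => (0 : ℝ)) →
          Tendsto (fun N : ℕ => (k N : ℝ) / Real.sqrt N) atTop (𝓝 0)) := by
  refine ⟨fun c hc => ?_, fun k hk hΘ Ω _ P _ ξ hξ => ?_, fun k hk Ω _ P _ ξ hξ hT => ?_⟩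
  -- The rate `c / 2` is eventually exceeded by every `k / √N → c`, so `b` can be fixed before `k`
  -- and the disorder.
  · obtain ⟨b, hb, H⟩ := Hopfield.exists_tendsto_measure_le_chaosDist.{u} hM (half_pos hc)
    refine ⟨b, hb, fun k hk hkc => H k hk atTop le_rfl ?_⟩
    filter_upwards [hkc.eventually_const_lt (half_lt_self hc), eventually_gt_atTop 0]
      with N h1 h2
    exact ((lt_div_iff₀ (Real.sqrt_pos.2 (by exact_mod_cast h2))).1 h1).le
  · obtain ⟨ε, hε, h⟩ := hΘ.2.exists_pos
    refine Hopfield.not_tendstoInMeasure_chaosDist hM (inv_pos.2 hε) hk le_rfl ?_ hξ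
    filter_upwards [h.bound] with N hN
    rw [Real.norm_of_nonneg (Real.sqrt_nonneg _), Real.norm_of_nonneg (Nat.cast_nonneg _)] at hN
    exact (inv_mul_le_iff₀ hε).2 hN
  · by_contra hcon
    rw [Metric.tendsto_nhds] at hcon
    push Not at hcon
    obtain ⟨ε, hε, hfreq⟩ := hcon
    -- The ratio stays above `ε` on an infinite set of sizes; the filter `atTop ⊓ 𝓟 s` plays the
    -- role of a subsequence along which chaos must fail.
    set s : Set ℕ := {N : ℕ | ε ≤ dist ((k N : ℝ) / Real.sqrt N) 0} with hs
    have hne : (atTop ⊓ 𝓟 s).NeBot := by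
      rw [← frequently_mem_iff_neBot]
      exact hfreq
    refine Hopfield.not_tendstoInMeasure_chaosDist (l := atTop ⊓ 𝓟 s) hM hε hk inf_le_left ?_ hξ
      fun δ hδ => (hT δ hδ).mono_left inf_le_left
    have hs' : ∀ᶠ N in atTop ⊓ 𝓟 s, N ∈ s := eventually_inf_principal.2 (by simp)
    filter_upwards [hs', (eventually_gt_atTop 0).filter_mono inf_le_left] with N h1 h2
    have h3 : 0 < √(N : ℝ) := Real.sqrt_pos.2 (by exact_mod_cast h2)
    rw [hs, Set.mem_ofPred_eq, Real.dist_eq, sub_zero, abs_of_nonneg (by positivity),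
      le_div_iff₀ h3] at h1
    exact h1
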